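/- Let $n\ge 1$ and equip $\mathbb{R}^n$ with the square metric $d(x,y)=\max_j|x_j-y_j|$, so that $B[0,1]=[-1,1]^n$ and $B[y,1]=y+B[0,1]$. Let $A$ be a diagonal matrix with diagonal entries $\beta_{11},\dots,\beta_{nn}\in(0,1/5)$, put $\beta_{\max}=\max_j\beta_{jj}$, and write $A^s=\operatorname{diag}(\beta_{11}^s,\dots,\beta_{nn}^s)$. Let $C\subseteq B[0,1]$ be compact. Let $E$ be the union of the unbounded connected components of $\mathbb{R}^n\setminus C$, and let $(G_k)_{k\in J}$, $J\subseteq\mathbb{N}$, list the bounded connected components of $\mathbb{R}^n\setminus C$, each exactly once, so that $S_A(G_k)$ is non-increasing in $k$, where $$S_A(U)=\inf\{t>0:\ U\subseteq A^{1/t}(B[0,1])+z\text{ for some }z\in\mathbb{R}^n\}\qquad(\inf\emptyset=\infty).$$ For $k\in J$ let $GD_A(k,C)$ be the infimum of all $t>0$ for which there is $z\in\mathbb{R}^n$ such that $A^{1/t}(B[0,1])+z$ meets both $G_k$ and $E\cup\bigcup_{i\in J,\,i<k}G_i$. The thickness of $C$ with respect to $A$ is $$\tau_A(C)=\inf_{k\in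 J}\{S_A(G_k)^{-1}-GD_A(k,C)^{-1}\},$$ with $\tau_A(C)=-\infty$ if $GD_A(k,C)=0$ for some $k\in J$; if $J=\emptyset$, then $\tau_A(C)=\infty$ if $C$ has non-empty interior and $\tau_A(C)=-\infty$ otherwise. Assume $\tau_A(C)\notin\{-\infty,\infty\}$ and put $\alpha=\prod_{j=1}^n\beta_{jj}^{\tau_A(C)-1}$. Suppose that $c,\delta\in(0,1)$ and $M\in\mathbb{N}$ satisfy $$M\alpha^c\le\delta^2\Bigl(1-\Bigl(\prod_{j=1}^n\beta_{jj}\Bigr)^{1-c}\Bigr)\quad\text{and}\quad 3^{-n}\prod_{j=1}^n\Bigl(1-5\beta_{jj}^{\lfloor\delta(M^{1/c}\alpha)^{-1}\rfloor}\Bigr)>8^n(1+2^{2n+1})\delta .$$ Then for every non-empty finite set $F\subset\mathbb{R}^n$ with at most $M$ elements, every $y\in\mathbb{R}^n$ and every $\lambda>0$ with $\lambda\operatorname{diam}(F)<1-\beta_{\max}$, there is a non-empty set $X\subseteq\mathbb{R}^n$ such that $\lambda F+x\subseteq(C\cup E)\cap B[y,1]$ for all $x\in X$, with the following additional property. Put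 $$K_M=2\delta^{-1}\left|\log\Bigl(3^{-n}\prod_{j=1}^n\bigl(1-5\beta_{jj}^{\lfloor\delta(M^{1/c}\alpha)^{-1}\rfloor}\bigr)-8^n(1+2^{2n+1})\delta\Bigr)\right| .$$ If moreover $$M\alpha^c\le\min\{\delta^2,\ K_M^{-1}\,n\log(\beta_{\max}^{-1})\}\Bigl(1-\Bigl(\prod_{j=1}^n\beta_{jj}\Bigr)^{1-c}\Bigr),$$ then $$\dim_H(X)\ \ge\ n-K_M\,\frac{M^{1/c}\alpha}{|\log\beta_{\max}|}\ >\ 0 .$$ -/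

import Mathlib

/- Throughout, `Fin n → ℝ` carries the sup norm, so its metric is the square metric
`d(x, y) = max_j |x j - y j|` and `Metric.closedBall 0 1 = [-1, 1]^n`. A diagonal matrix `A`
with positive entries is given by its diagonal `β`. -/

namespace AffineThickness

open Set Metric

variable {n : ℕ}

/-- The real power `A ^ s` of the diagonal matrix `A` with diagonal entries `β j`. -/
noncomputable def diagPow (β : Fin n → ℝ) (s : ℝ) : Matrix (Fin n) (Fin n) ℝ :=
  Matrix.diagonal fun j => β j ^ s

/-- The translated box `A ^ s (B[0,1]) + z`. -/
def box (β : Fin n → ℝ) (s : ℝ) (z : Fin n → ℝ) : Set (Fin n → ℝ) :=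
  (fun v => (diagPow β s).mulVec v + z) '' closedBall 0 1

/-- The bounded gaps of `C`: the bounded connected components of the complement of `C`. (For closed
`C` the complement is open, so these are also its bounded path components.) -/
def boundedGaps (C : Set (Fin n → ℝ)) : Set (Set (Fin n → ℝ)) :=
  {U | ∃ x ∈ Cᶜ, U = connectedComponentIn Cᶜ x ∧ Bornology.IsBounded U}

/-- The outer gap `E`: the union of the unbounded connected components of the complement of `C`.
For compact `C` and `n ≥ 2` there is exactly one such component; for `n = 1` and `C ≠ ∅` there
are two. -/
def outerGap (C : Set (Fin n → ℝ)) : Set (Fin n → ℝ) :=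
  {x | x ∈ Cᶜ ∧ ¬ Bornology.IsBounded (connectedComponentIn Cᶜ x)}

/-- The size `S_A(F) = inf {t > 0 : F ⊆ A^{1/t}(B[0,1]) + z for some z}`, with `inf ∅ = ∞`. -/
noncomputable def affineSize (β : Fin n → ℝ) (F : Set (Fin n → ℝ)) : ENNReal :=
  ⨅ (t : ℝ) (_ : 0 < t ∧ ∃ z, F ⊆ box β (1 / t) z), ENNReal.ofReal t

/-- `(G k)` for `k ∈ J` lists every bounded gap of `C` exactly once, in non-increasing size with
respect to `A`. -/
structure IsGapEnumeration (β : Fin n → ℝ) (C : Set (Fin n → ℝ)) (J : Set ℕ)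
    (G : ℕ → Set (Fin n → ℝ)) : Prop where
  injOn : InjOn G J
  image_eq : G '' J = boundedGaps C
  antitoneOn_size : AntitoneOn (fun k => affineSize β (G k)) J

/-- The gap distance `GD_A(m, C)`: the infimum of all `t > 0` such that some translate of
`A^{1/t}(B[0,1])` meets both `G m` and the union of `E` and the gaps listed before `G m`. -/
noncomputable def gapDist (β : Fin n → ℝ) (C : Set (Fin n → ℝ)) (J : Set ℕ)
    (G : ℕ → Set (Fin n → ℝ)) (m : ℕ) : ENNReal :=
  ⨅ (t : ℝ) (_ : 0 < t ∧ ∃ z, (G m ∩ box β (1 / t) z).Nonempty ∧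
      (box β (1 / t) z ∩ ((⋃ i ∈ {i ∈ J | i < m}, G i) ∪ outerGap C)).Nonempty),
    ENNReal.ofReal t

open Classical in
/-- The thickness `τ_A(C)` with respect to `A`, computed from an enumeration of the bounded gaps
in non-increasing size. -/
noncomputable def thickness (β : Fin n → ℝ) (C : Set (Fin n → ℝ)) (J : Set ℕ)
    (G : ℕ → Set (Fin n → ℝ)) : EReal :=
  if J = ∅ then (if (interior C).Nonempty then ⊤ else ⊥)
  else if ∃ k ∈ J, gapDist β C J G k = 0 then ⊥
  else ⨅ k ∈ J, (((affineSize β (G k))⁻¹ : ENNReal) : EReal) -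
    (((gapDist β C J G k)⁻¹ : ENNReal) : EReal)

/-- `α_τ = ∏_j β_jj ^ (τ - 1)`. -/
noncomputable def alphaOf (β : Fin n → ℝ) (τ : ℝ) : ℝ := ∏ j, β j ^ (τ - 1)

/-- `β_max = max_j β_jj` (for `n ≥ 1`). -/
noncomputable def betaMax (β : Fin n → ℝ) : ℝ := ⨆ j, β j

/-- `3^{-n} ∏_j (1 - 5 β_jj ^ ⌊δ (M^{1/c} α)⁻¹⌋)`. -/
noncomputable def sepFactor (β : Fin n → ℝ) (α c δ : ℝ) (M : ℕ) : ℝ :=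
  ((3 : ℝ) ^ n)⁻¹ * ∏ j, (1 - 5 * β j ^ ⌊δ * ((M : ℝ) ^ (1 / c) * α)⁻¹⌋₊)

/-- `K_M = 2 δ⁻¹ |log (3^{-n} ∏_j (1 - 5 β_jj ^ ⌊δ (M^{1/c} α)⁻¹⌋) - 8^n (1 + 2^{2n+1}) δ)|`. -/
noncomputable def patternConst (β : Fin n → ℝ) (α c δ : ℝ) (M : ℕ) : ℝ :=
  2 * δ⁻¹ * |Real.log (sepFactor β α c δ M - 8 ^ n * (1 + 2 ^ (2 * n + 1)) * δ)|

end AffineThickness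

/-! A translate of `λF` fails to lie in `C ∪ E` only if one of its points falls into a bounded gap.
The thickness turns this into avoiding a sparse family of boxes. If a box of exponent `s` meets `G
k` and also `E` or an earlier gap, then `G k` lies in a box of exponent `s + τ` (`gap_subset_box`).
So for each cell of the grid with sides `2 β_j ^ m` and each `b ∈ F`, delete one box of exponent `m
+ τ - 1`: the one containing the first gap that meets the cell translated by `λb`. Its volume is `α`
times that of the cell. These deletions catch every point of a bounded gap (`mem_union_outerGap`).

It remains to find a large set that avoids all these holes. Write `D = ∏ β_j`. A cell is good if the
holes of lower levels meeting it have small total `c`-th power of volume. A point in good cells of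
arbitrarily high level is in no hole: a single hole containing it would keep the potential bounded
below, while the bound `(δ D ^ l) ^ c` tends to `0`. Double counting shows that a good cell has at
least `κ D ^ (-N)` good subcells `N` levels further down (`le_card_good_children`), where `κ > 0` is
the quantity inside the logarithm of `K_M` and `N = ⌊δ / (M ^ (1/c) α)⌋`. The factor `N` must be
small enough for the new holes to be few and large enough for the old ones to be diluted
(`scale_bounds`, `pow_le_of_le_one_sub`).

Choosing `⌈κ D ^ (-N)⌉` good subcells at each step gives a tree. The uniform measure on its branches
satisfies a ball estimate of order `s` whenever `b ^ (N n) ≤ κ b ^ (N s)` with `b = β_max`, so the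
mass distribution principle bounds the dimension (`IsTree.le_dimH_range`).
`pow_le_mul_rpow_of_scale` checks this for the claimed `s`. -/

namespace AffineThickness

open Set Metric MeasureTheory Filter Topology
open scoped ENNReal

variable {n : ℕ}

/-! ### Grid cells and their subcells -/

/-- The grid cell of level `m` with index `k`: a box with side lengths `2 β_j ^ m`. -/
def tile (β : Fin n → ℝ) (m : ℕ) (k : Fin n → ℤ) : Set (Fin n → ℝ) :=
  Icc (fun j => 2 * β j ^ m * k j) (fun j => 2 * β j ^ m * (k j + 1))

/-- A finite set containing the indices of all cells of level `m` that meet `Icc p q`. -/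
noncomputable def meetIdx (β : Fin n → ℝ) (m : ℕ) (p q : Fin n → ℝ) : Finset (Fin n → ℤ) :=
  Fintype.piFinset fun j => Finset.Icc (⌈p j / (2 * β j ^ m)⌉ - 1) ⌊q j / (2 * β j ^ m)⌋

theorem mem_meetIdx {β : Fin n → ℝ} (hβ : ∀ j, 0 < β j) {m : ℕ} {k : Fin n → ℤ}
    {p q : Fin n → ℝ} (h : (tile β m k ∩ Icc p q).Nonempty) : k ∈ meetIdx β m p q := by
  obtain ⟨x, ⟨h1, h2⟩, h3, h4⟩ := h
  refine Fintype.mem_piFinset.2 fun j => ?_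
  have hb : 0 < 2 * β j ^ m := by have := pow_pos (hβ j) m; positivity
  have a1 : 2 * β j ^ m * k j ≤ x j := h1 j
  have a2 : x j ≤ 2 * β j ^ m * (k j + 1) := h2 j
  rw [Finset.mem_Icc]
  constructor
  · have : ⌈p j / (2 * β j ^ m)⌉ ≤ k j + 1 := by
      rw [Int.ceil_le, div_le_iff₀ hb]
      push_cast
      linarith [h3 j]
    omega
  · rw [Int.le_floor, le_div_iff₀ hb]
    linarith [h4 j]

theorem card_meetIdx_le {β : Fin n → ℝ} (hβ : ∀ j, 0 < β j) (m : ℕ) {p q : Fin n → ℝ}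
    (hpq : p ≤ q) :
    ((meetIdx β m p q).card : ℝ) ≤ ∏ j, ((q j - p j) / (2 * β j ^ m) + 2) := by
  rw [meetIdx, Fintype.card_piFinset]
  push_cast
  refine Finset.prod_le_prod (fun _ _ => by positivity) fun j _ => ?_
  have hb : 0 < 2 * β j ^ m := by have := pow_pos (hβ j) m; positivity
  have hd : p j / (2 * β j ^ m) ≤ q j / (2 * β j ^ m) := by gcongr; exact hpq j
  rw [Int.card_Icc, sub_div]
  have h1 := Int.floor_le (q j / (2 * β j ^ m))
  have h2 := Int.le_ceil (p j / (2 * β j ^ m))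
  set u := ⌊q j / (2 * β j ^ m)⌋
  set v := ⌈p j / (2 * β j ^ m)⌉
  rcases le_total 0 (u + 1 - (v - 1)) with h | h
  · have : (((u + 1 - (v - 1)).toNat : ℤ) : ℝ) = ((u + 1 - (v - 1) : ℤ) : ℝ) := by
      rw [Int.toNat_of_nonneg h]
    rw [Int.cast_natCast] at this
    rw [this]
    push_cast
    linarith
  · rw [Int.toNat_of_nonpos h]
    push_cast
    linarith

/-- The indices of the cells of level `l + N` contained in the cell of level `l` with index `K`. -/
noncomputable def children (β : Fin n → ℝ) (N : ℕ) (K : Fin n → ℤ) : Finset (Fin n → ℤ) :=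
  Fintype.piFinset fun j => Finset.Icc ⌈K j / β j ^ N⌉ (⌊(K j + 1) / β j ^ N⌋ - 1)

theorem children_bounds {β : Fin n → ℝ} (hβ : ∀ j, 0 < β j) {N : ℕ} {K K' : Fin n → ℤ}
    (h : K' ∈ children β N K) (j : Fin n) :
    (K j : ℝ) ≤ β j ^ N * K' j ∧ β j ^ N * (K' j + 1) ≤ K j + 1 := by
  have hb := pow_pos (hβ j) N
  have := Finset.mem_Icc.1 (Fintype.mem_piFinset.1 h j)
  constructor
  · have h1 := Int.ceil_le.1 this.1
    rw [div_le_iff₀ hb] at h1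
    linarith
  · have h1 : K' j + 1 ≤ ⌊(K j + 1) / β j ^ N⌋ := by omega
    have h2 := Int.le_floor.1 h1
    rw [le_div_iff₀ hb] at h2
    push_cast at h2
    linarith

theorem tile_subset_of_mem_children {β : Fin n → ℝ} (hβ : ∀ j, 0 < β j) {N : ℕ}
    {K K' : Fin n → ℤ} (h : K' ∈ children β N K) (l : ℕ) :
    tile β (l + N) K' ⊆ tile β l K := by
  refine Icc_subset_Icc (fun j => ?_) (fun j => ?_)
  all_goals
    have hb := pow_pos (hβ j) l
    obtain ⟨h1, h2⟩ := children_bounds hβ h j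
    have h1 := mul_le_mul_of_nonneg_left h1 hb.le
    have h2 := mul_le_mul_of_nonneg_left h2 hb.le
    simp only [pow_add]
    nlinarith

/-- Grids of different levels need not be nested, since `β_j ^ (-N)` need not be an integer. A cell
that does lie in a coarser one still determines it, by rounding down its corner. -/
theorem eq_of_mem_children {β : Fin n → ℝ} (hβ : ∀ j, 0 < β j) {N : ℕ} {K L K' : Fin n → ℤ}
    (h : K' ∈ children β N K) (h' : K' ∈ children β N L) : K = L := by
  have key : ∀ {K : Fin n → ℤ}, K' ∈ children β N K → ∀ j, K j = ⌊β j ^ N * K' j⌋ := by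
    intro K h j
    obtain ⟨h1, h2⟩ := children_bounds hβ h j
    have hb := pow_pos (hβ j) N
    exact (Int.floor_eq_iff.2 ⟨h1, by linarith⟩).symm
  funext j
  rw [key h j, key h' j]

theorem le_card_children {β : Fin n → ℝ} (hβ : ∀ j, 0 < β j) {N : ℕ}
    (hN : ∀ j, 5 * β j ^ N < 1) (K : Fin n → ℤ) :
    (∏ j, (1 - 2 * β j ^ N)) * ((∏ j, β j) ^ N)⁻¹ ≤ ((children β N K).card : ℝ) := by
  rw [children, Fintype.card_piFinset, ← Finset.prod_pow, ← Finset.prod_inv_distrib,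
    ← Finset.prod_mul_distrib]
  push_cast
  refine Finset.prod_le_prod (fun j _ => ?_) fun j _ => ?_
  · have hb := pow_pos (hβ j) N
    have := hN j
    have : 0 ≤ 1 - 2 * β j ^ N := by linarith
    positivity
  · have hb := pow_pos (hβ j) N
    rw [Int.card_Icc]
    have h0 : (((⌊((K j : ℝ) + 1) / β j ^ N⌋ - 1 + 1 - ⌈(K j : ℝ) / β j ^ N⌉ : ℤ)) : ℝ) ≤
        (((⌊((K j : ℝ) + 1) / β j ^ N⌋ - 1 + 1 - ⌈(K j : ℝ) / β j ^ N⌉).toNat : ℤ) : ℝ) :=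
      Int.cast_le.2 (Int.self_le_toNat _)
    rw [Int.cast_natCast] at h0
    refine le_trans ?_ h0
    push_cast
    have h1 := Int.sub_one_lt_floor (((K j : ℝ) + 1) / β j ^ N)
    have h2 := Int.ceil_lt_add_one ((K j : ℝ) / β j ^ N)
    have h3 : (1 - 2 * β j ^ N) * (β j ^ N)⁻¹ = (β j ^ N)⁻¹ - 2 := by field_simp
    rw [h3]
    rw [add_div, one_div] at *
    linarith

/-! ### Counting the holes that meet a cell -/

section Grid

variable {ι : Type*} [Fintype ι]

/-- The box with half side lengths `β_j ^ (m + θ)` and centre `w m k b`, removed on behalf of the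
cell of level `m` with index `k`. -/
def hole (β : Fin n → ℝ) (θ : ℝ) (w : ℕ → (Fin n → ℤ) → ι → Fin n → ℝ) (m : ℕ)
    (k : Fin n → ℤ) (b : ι) : Set (Fin n → ℝ) :=
  Icc (fun j => w m k b j - β j ^ ((m : ℝ) + θ)) (fun j => w m k b j + β j ^ ((m : ℝ) + θ))

open Classical in
/-- The holes of level `m` that meet the cell of level `l` with index `K` and belong to a cell that
meets it as well. -/
noncomputable def hits (β : Fin n → ℝ) (θ : ℝ) (w : ℕ → (Fin n → ℤ) → ι → Fin n → ℝ)
    (m l : ℕ) (K : Fin n → ℤ) : Finset ((Fin n → ℤ) × ι) :=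
  (meetIdx β m (fun j => 2 * β j ^ l * K j) (fun j => 2 * β j ^ l * (K j + 1)) ×ˢ
    Finset.univ).filter fun x =>
      (tile β m x.1 ∩ tile β l K).Nonempty ∧ (hole β θ w m x.1 x.2 ∩ tile β l K).Nonempty

/-- A hole may lie far from the cell it belongs to. Requiring that cell to meet the given one as
well keeps the family finite and countable by volume. -/
theorem mem_hits {β : Fin n → ℝ} (hβ : ∀ j, 0 < β j) {θ : ℝ}
    {w : ℕ → (Fin n → ℤ) → ι → Fin n → ℝ} {m l : ℕ} {K : Fin n → ℤ} {x : (Fin n → ℤ) × ι} :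
    x ∈ hits β θ w m l K ↔
      (tile β m x.1 ∩ tile β l K).Nonempty ∧ (hole β θ w m x.1 x.2 ∩ tile β l K).Nonempty := by
  classical
  rw [hits, Finset.mem_filter, Finset.mem_product]
  exact ⟨fun h => h.2, fun h => ⟨⟨mem_meetIdx hβ h.1, Finset.mem_univ _⟩, h⟩⟩

theorem hits_subset {β : Fin n → ℝ} (hβ : ∀ j, 0 < β j) {θ : ℝ}
    {w : ℕ → (Fin n → ℤ) → ι → Fin n → ℝ} {m l N : ℕ} {K K' : Fin n → ℤ}
    (h : K' ∈ children β N K) : hits β θ w m (l + N) K' ⊆ hits β θ w m l K := by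
  intro x hx
  rw [mem_hits hβ] at hx ⊢
  have := tile_subset_of_mem_children hβ h l
  exact ⟨hx.1.mono (inter_subset_inter_right _ this), hx.2.mono (inter_subset_inter_right _ this)⟩

theorem card_hits_le {β : Fin n → ℝ} (hβ : ∀ j, 0 < β j) (hβ1 : ∀ j, β j ≤ 1) {θ : ℝ}
    {w : ℕ → (Fin n → ℤ) → ι → Fin n → ℝ} {m l : ℕ} (hlm : l ≤ m) {K : Fin n → ℤ} :
    ((hits β θ w m l K).card : ℝ) ≤
      3 ^ n * ((∏ j, β j) ^ l / (∏ j, β j) ^ m) * Fintype.card ι := by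
  classical
  have h1 : (hits β θ w m l K).card ≤
      (meetIdx β m (fun j => 2 * β j ^ l * K j) (fun j => 2 * β j ^ l * (K j + 1))).card *
        Fintype.card ι := by
    rw [← Finset.card_univ, ← Finset.card_product]
    exact Finset.card_filter_le _ _
  have h2 := card_meetIdx_le hβ m (p := fun j => 2 * β j ^ l * K j)
    (q := fun j => 2 * β j ^ l * (K j + 1)) fun j => by
      have := pow_pos (hβ j) l
      simp only
      nlinarith
  have h3 : (∏ j, ((2 * β j ^ l * ((K j : ℝ) + 1) - 2 * β j ^ l * K j) / (2 * β j ^ m) + 2)) ≤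
      3 ^ n * ((∏ j, β j) ^ l / (∏ j, β j) ^ m) := by
    have : (3 : ℝ) ^ n = ∏ _j : Fin n, 3 := by simp
    rw [this, ← Finset.prod_pow, ← Finset.prod_pow, ← Finset.prod_div_distrib,
      ← Finset.prod_mul_distrib]
    refine Finset.prod_le_prod (fun j _ => ?_) fun j _ => ?_
    all_goals
      have hl := pow_pos (hβ j) l
      have hm := pow_pos (hβ j) m
      have e : (2 * β j ^ l * ((K j : ℝ) + 1) - 2 * β j ^ l * K j) / (2 * β j ^ m) =
        β j ^ l / β j ^ m := by field_simp; ring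
      rw [e]
    · positivity
    · have : 1 ≤ β j ^ l / β j ^ m := by
        rw [one_le_div hm]
        exact pow_le_pow_of_le_one (hβ j).le (hβ1 j) hlm
      linarith
  refine (Nat.cast_le.2 h1).trans ?_
  rw [Nat.cast_mul]
  exact mul_le_mul_of_nonneg_right (h2.trans h3) (Nat.cast_nonneg _)

/-- Double counting: every hole counted for a subcell is already counted for the parent, and one
hole meets only boundedly many subcells beyond its share of volume. -/
theorem sum_card_hits_le {β : Fin n → ℝ} (hβ : ∀ j, 0 < β j) (hβ1 : ∀ j, β j ≤ 1) {θ : ℝ}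
    {w : ℕ → (Fin n → ℤ) → ι → Fin n → ℝ} {m l N : ℕ} {K : Fin n → ℤ} :
    (∑ K' ∈ children β N K, ((hits β θ w m (l + N) K').card : ℝ)) ≤
      (hits β θ w m l K).card *
        (3 ^ n * max 1 ((∏ j, β j) ^ ((m : ℝ) + θ) / (∏ j, β j) ^ (l + N))) := by
  classical
  have h1 : ∀ K' ∈ children β N K, ((hits β θ w m (l + N) K').card : ℝ) =
      ∑ x ∈ hits β θ w m l K, if x ∈ hits β θ w m (l + N) K' then (1 : ℝ) else 0 := by
    intro K' hK'
    rw [Finset.sum_ite_mem, Finset.inter_eq_right.2 (hits_subset hβ hK')]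
    simp
  rw [Finset.sum_congr rfl h1, Finset.sum_comm, ← nsmul_eq_mul]
  refine Finset.sum_le_card_nsmul _ _ _ fun x _ => ?_
  rw [Finset.sum_ite, Finset.sum_const_zero, add_zero, Finset.sum_const, nsmul_one]
  have h2 : (children β N K).filter (fun K' => x ∈ hits β θ w m (l + N) K') ⊆
      meetIdx β (l + N) (fun j => w m x.1 x.2 j - β j ^ ((m : ℝ) + θ))
        (fun j => w m x.1 x.2 j + β j ^ ((m : ℝ) + θ)) := by
    intro K' hK'
    have h := ((mem_hits hβ).1 (Finset.mem_filter.1 hK').2).2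
    rw [inter_comm] at h
    exact mem_meetIdx hβ h
  have h3 := card_meetIdx_le hβ (l + N) (p := fun j => w m x.1 x.2 j - β j ^ ((m : ℝ) + θ))
    (q := fun j => w m x.1 x.2 j + β j ^ ((m : ℝ) + θ)) fun j => by
      have := Real.rpow_pos_of_pos (hβ j) ((m : ℝ) + θ)
      simp only
      linarith
  refine (Nat.cast_le.2 (Finset.card_le_card h2)).trans (h3.trans ?_)
  have e : ∀ j, (w m x.1 x.2 j + β j ^ ((m : ℝ) + θ) - (w m x.1 x.2 j - β j ^ ((m : ℝ) + θ))) /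
      (2 * β j ^ (l + N)) = β j ^ ((m : ℝ) + θ) / β j ^ (l + N) := by
    intro j
    have hl := pow_pos (hβ j) (l + N)
    field_simp
    ring
  have h0 : ∀ j, 0 < β j ^ ((m : ℝ) + θ) / β j ^ (l + N) := fun j => by
    have := pow_pos (hβ j) (l + N)
    have := Real.rpow_pos_of_pos (hβ j) ((m : ℝ) + θ)
    positivity
  have h3n : (3 : ℝ) ^ n = ∏ _j : Fin n, 3 := by simp
  simp only [e]
  -- The sign of `m + θ - (l + N)` decides, for all coordinates at once, whether the hole is smaller
  -- or larger than a subcell. Hence the product of the coordinate bounds is governed by the volume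
  -- ratio.
  rcases le_total ((m : ℝ) + θ) ((l + N : ℕ) : ℝ) with hc | hc
  · refine le_trans ?_ (mul_le_mul_of_nonneg_left (le_max_right _ _) (by positivity))
    rw [h3n, ← Real.finsetProd_rpow _ _ (fun j _ => (hβ j).le), ← Finset.prod_pow,
      ← Finset.prod_div_distrib, ← Finset.prod_mul_distrib]
    refine Finset.prod_le_prod (fun j _ => by have := h0 j; positivity) fun j _ => ?_
    have : 1 ≤ β j ^ ((m : ℝ) + θ) / β j ^ (l + N) := by
      rw [one_le_div (pow_pos (hβ j) _), ← Real.rpow_natCast]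
      exact Real.rpow_le_rpow_of_exponent_ge (hβ j) (hβ1 j) hc
    linarith
  · refine le_trans ?_ (mul_le_mul_of_nonneg_left (le_max_left _ _) (by positivity))
    rw [h3n, mul_one]
    refine Finset.prod_le_prod (fun j _ => by have := h0 j; positivity) fun j _ => ?_
    have : β j ^ ((m : ℝ) + θ) / β j ^ (l + N) ≤ 1 := by
      rw [div_le_one (pow_pos (hβ j) _), ← Real.rpow_natCast]
      exact Real.rpow_le_rpow_of_exponent_ge (hβ j) (hβ1 j) hc
    linarith

/-! ### Potential and good cells -/

/-- The potential of the cell of level `l` with index `K`: the sum of the `c`-th powers of the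
volumes of the holes of lower levels that meet it. -/
noncomputable def potential (β : Fin n → ℝ) (θ c : ℝ) (w : ℕ → (Fin n → ℤ) → ι → Fin n → ℝ)
    (l : ℕ) (K : Fin n → ℤ) : ℝ :=
  ∑ m ∈ Finset.Ico 1 l, (hits β θ w m l K).card * ((∏ j, β j) ^ ((m : ℝ) + θ)) ^ c

/-- A cell is good if its potential is small compared with its volume. -/
def IsGood (β : Fin n → ℝ) (θ c δ : ℝ) (w : ℕ → (Fin n → ℤ) → ι → Fin n → ℝ)
    (l : ℕ) (K : Fin n → ℤ) : Prop :=
  potential β θ c w l K ≤ (δ * (∏ j, β j) ^ l) ^ c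

/-- The multiplicities are integers, so a term with `x m > 1` that occurs at all already contributes
`1` after truncation. Truncating makes the sum over bad subcells insensitive to single large holes.
-/
theorem one_le_sum_mul_min {s : Finset ℕ} {t x : ℕ → ℝ} (ht : ∀ m, ∃ k : ℕ, t m = k)
    (hx : ∀ m, 0 ≤ x m) (h : 1 < ∑ m ∈ s, t m * x m) : 1 ≤ ∑ m ∈ s, t m * min 1 (x m) := by
  have t0 : ∀ m, 0 ≤ t m := fun m => by obtain ⟨k, hk⟩ := ht m; rw [hk]; positivity
  by_cases hm : ∃ m ∈ s, 1 < x m ∧ t m ≠ 0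
  · obtain ⟨m, hms, h1, h2⟩ := hm
    have h3 : 1 ≤ t m := by
      obtain ⟨k, hk⟩ := ht m
      rw [hk] at h2 ⊢
      exact_mod_cast Nat.one_le_iff_ne_zero.2 (by exact_mod_cast h2)
    calc (1 : ℝ) ≤ t m * min 1 (x m) := by rw [min_eq_left h1.le, mul_one]; exact h3
      _ ≤ _ := Finset.single_le_sum (f := fun m => t m * min 1 (x m))
        (fun i _ => mul_nonneg (t0 i) (le_min zero_le_one (hx i))) hms
  · push Not at hm
    refine h.le.trans (le_of_eq (Finset.sum_congr rfl fun m hms => ?_))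
    rcases le_or_gt (x m) 1 with h1 | h1
    · rw [min_eq_right h1]
    · rw [hm m hms h1, zero_mul, zero_mul]

theorem min_mul_max_le {v u δ c : ℝ} (hv : 0 < v) (hu : 0 < u) (hδ : 0 < δ) :
    min 1 ((v / (δ * u)) ^ c) * max 1 (v / u) ≤ (v / (δ * u)) ^ c + v / u := by
  have h1 : 0 < v / u := by positivity
  have h2 : 0 < (v / (δ * u)) ^ c := by positivity
  rcases le_total 1 (v / u) with h | h
  · rw [max_eq_right h]
    nlinarith [min_le_left 1 ((v / (δ * u)) ^ c)]
  · rw [max_eq_left h, mul_one]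
    linarith [min_le_right 1 ((v / (δ * u)) ^ c)]

/-- Markov's inequality for the truncated potential: each bad subcell carries weight at least `1`,
and the total weight over all subcells is bounded by double counting. -/
theorem card_filter_not_isGood_le {β : Fin n → ℝ} (hβ : ∀ j, 0 < β j) (hβ1 : ∀ j, β j ≤ 1)
    {θ c δ : ℝ} (hδ : 0 < δ) {w : ℕ → (Fin n → ℤ) → ι → Fin n → ℝ}
    {l N : ℕ} {K : Fin n → ℤ} [DecidablePred (IsGood β θ c δ w (l + N))] :
    (((children β N K).filter fun K' => ¬ IsGood β θ c δ w (l + N) K').card : ℝ) ≤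
      3 ^ n * ∑ m ∈ Finset.Ico 1 (l + N), (hits β θ w m l K).card *
        (((∏ j, β j) ^ ((m : ℝ) + θ) / (δ * (∏ j, β j) ^ (l + N))) ^ c +
          (∏ j, β j) ^ ((m : ℝ) + θ) / (∏ j, β j) ^ (l + N)) := by
  set D := ∏ j, β j with hD
  have hD0 : 0 < D := Finset.prod_pos fun j _ => hβ j
  set u := D ^ (l + N) with hu
  have hu0 : 0 < u := pow_pos hD0 _
  set v : ℕ → ℝ := fun m => D ^ ((m : ℝ) + θ) with hv
  have hv0 : ∀ m, 0 < v m := fun m => Real.rpow_pos_of_pos hD0 _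
  set g : ℕ → ℝ := fun m => (v m / (δ * u)) ^ c with hg
  have hg0 : ∀ m, 0 ≤ g m := fun m => by have := hv0 m; positivity
  have hbad : ∀ K' ∈ (children β N K).filter fun K' => ¬ IsGood β θ c δ w (l + N) K',
      (1 : ℝ) ≤ ∑ m ∈ Finset.Ico 1 (l + N),
        ((hits β θ w m (l + N) K').card : ℝ) * min 1 (g m) := by
    intro K' hK'
    have h := (Finset.mem_filter.1 hK').2
    rw [IsGood, not_le, potential, ← hD, ← hu] at h
    refine one_le_sum_mul_min (fun m => ⟨_, rfl⟩) hg0 ?_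
    have hp : 0 < (δ * u) ^ c := by positivity
    have : ∑ m ∈ Finset.Ico 1 (l + N), ((hits β θ w m (l + N) K').card : ℝ) * g m =
        (∑ m ∈ Finset.Ico 1 (l + N), ((hits β θ w m (l + N) K').card : ℝ) * (v m) ^ c) /
          (δ * u) ^ c := by
      rw [Finset.sum_div]
      refine Finset.sum_congr rfl fun m _ => ?_
      rw [hg]
      simp only
      rw [Real.div_rpow (hv0 m).le (by positivity), mul_div_assoc]
    rw [this, one_lt_div hp]
    exact h
  calc (((children β N K).filter fun K' => ¬ IsGood β θ c δ w (l + N) K').card : ℝ)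
      = ∑ _K' ∈ (children β N K).filter fun K' => ¬ IsGood β θ c δ w (l + N) K', (1 : ℝ) := by
        simp
    _ ≤ ∑ K' ∈ (children β N K).filter fun K' => ¬ IsGood β θ c δ w (l + N) K',
        ∑ m ∈ Finset.Ico 1 (l + N), ((hits β θ w m (l + N) K').card : ℝ) * min 1 (g m) :=
        Finset.sum_le_sum hbad
    _ ≤ ∑ K' ∈ children β N K,
        ∑ m ∈ Finset.Ico 1 (l + N), ((hits β θ w m (l + N) K').card : ℝ) * min 1 (g m) :=
        Finset.sum_le_sum_of_subset_of_nonneg (Finset.filter_subset _ _) fun _ _ _ =>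
          Finset.sum_nonneg fun m _ => mul_nonneg (Nat.cast_nonneg _)
            (le_min zero_le_one (hg0 m))
    _ = ∑ m ∈ Finset.Ico 1 (l + N),
        (∑ K' ∈ children β N K, ((hits β θ w m (l + N) K').card : ℝ)) * min 1 (g m) := by
        rw [Finset.sum_comm]
        simp_rw [Finset.sum_mul]
    _ ≤ _ := by
        rw [Finset.mul_sum]
        refine Finset.sum_le_sum fun m _ => ?_
        refine (mul_le_mul_of_nonneg_right (sum_card_hits_le hβ hβ1)
          (le_min zero_le_one (hg0 m))).trans ?_
        have := min_mul_max_le (c := c) (hv0 m) hu0 hδ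
        calc _ = 3 ^ n * ((hits β θ w m l K).card *
              (min 1 ((v m / (δ * u)) ^ c) * max 1 (v m / u))) := by rw [hg]; ring
          _ ≤ _ := by gcongr

/-- Holes older than `K` are controlled by the goodness of `K`. It bounds each hole volume `v` that
occurs by `δ D ^ l`, so `v = v ^ c * v ^ (1 - c)` is dominated by `v ^ c`, whose sum is the
potential. The other part gains `(D ^ (1 - c)) ^ N ≤ δ`. -/
theorem sum_hits_old_le {β : Fin n → ℝ} (hβ : ∀ j, 0 < β j) 
    {θ c δ : ℝ} (hδ : 0 < δ) (hc : c ∈ Ioo (0 : ℝ) 1) {w : ℕ → (Fin n → ℤ) → ι → Fin n → ℝ}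
    {l N : ℕ} {K : Fin n → ℤ} (hK : IsGood β θ c δ w l K)
    (hN : ((∏ j, β j) ^ (1 - c)) ^ N ≤ δ) :
    ∑ m ∈ Finset.Ico 1 l, ((hits β θ w m l K).card : ℝ) *
        (((∏ j, β j) ^ ((m : ℝ) + θ) / (δ * (∏ j, β j) ^ (l + N))) ^ c +
          (∏ j, β j) ^ ((m : ℝ) + θ) / (∏ j, β j) ^ (l + N)) ≤
      2 * δ * ((∏ j, β j) ^ N)⁻¹ := by
  set D := ∏ j, β j with hD
  have hD0 : 0 < D := Finset.prod_pos fun j _ => hβ j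
  set u := D ^ (l + N) with hu
  have hu0 : 0 < u := pow_pos hD0 _
  have hl0 : 0 < D ^ l := pow_pos hD0 _
  have hN0 : 0 < D ^ N := pow_pos hD0 _
  set v : ℕ → ℝ := fun m => D ^ ((m : ℝ) + θ) with hv
  have hv0 : ∀ m, 0 < v m := fun m => Real.rpow_pos_of_pos hD0 _
  rw [IsGood, potential, ← hD] at hK
  have huD : u = D ^ l * D ^ N := pow_add _ _ _
  have hle : ∀ m ∈ Finset.Ico 1 l, ((hits β θ w m l K).card : ℝ) *
      ((v m / (δ * u)) ^ c + v m / u) ≤ ((hits β θ w m l K).card * v m ^ c) *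
        (((δ * u) ^ c)⁻¹ + (δ * D ^ l) ^ (1 - c) / u) := by
    intro m hm
    rcases Nat.eq_zero_or_pos (hits β θ w m l K).card with h | h
    · rw [h]; simp
    · have h1 : (1 : ℝ) ≤ (hits β θ w m l K).card := by exact_mod_cast h
      have hvc : 0 < v m ^ c := Real.rpow_pos_of_pos (hv0 m) _
      have h2 : v m ^ c ≤ (δ * D ^ l) ^ c := by
        have := Finset.single_le_sum (f := fun m => ((hits β θ w m l K).card : ℝ) * v m ^ c)
          (fun i _ => mul_nonneg (Nat.cast_nonneg _) (Real.rpow_nonneg (hv0 i).le _)) hm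
        have h3 : ((hits β θ w m l K).card : ℝ) * v m ^ c ≤ _ := this.trans hK
        nlinarith
      have h4 : v m ≤ δ * D ^ l := (Real.rpow_le_rpow_iff (hv0 m).le (by positivity) hc.1).1 h2
      have h5 : v m ^ (1 - c) ≤ (δ * D ^ l) ^ (1 - c) :=
        Real.rpow_le_rpow (hv0 m).le h4 (by linarith [hc.2])
      have h6 : v m = v m ^ c * v m ^ (1 - c) := by
        rw [← Real.rpow_add (hv0 m)]; simp
      have h7 : v m / u ≤ v m ^ c * ((δ * D ^ l) ^ (1 - c) / u) := by
        rw [← mul_div_assoc]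
        gcongr
        exact h6.le.trans (by gcongr)
      rw [Real.div_rpow (hv0 m).le (by positivity), mul_assoc]
      refine mul_le_mul_of_nonneg_left ?_ (Nat.cast_nonneg _)
      rw [mul_add, ← div_eq_mul_inv]
      gcongr
  refine (Finset.sum_le_sum hle).trans ?_
  rw [← Finset.sum_mul]
  have hp : 0 ≤ ((δ * u) ^ c)⁻¹ + (δ * D ^ l) ^ (1 - c) / u := by positivity
  refine (mul_le_mul_of_nonneg_right hK hp).trans ?_
  have hpos : 0 < δ * D ^ l := by positivity
  have e1 : (δ * D ^ l) ^ c * ((δ * u) ^ c)⁻¹ = (D ^ (1 - c)) ^ N * (D ^ N)⁻¹ := by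
    have : (δ * u) ^ c = (δ * D ^ l) ^ c * (D ^ N) ^ c := by
      rw [← Real.mul_rpow hpos.le hN0.le, huD, mul_assoc]
    rw [this, mul_inv, mul_inv_cancel_left₀ (Real.rpow_pos_of_pos hpos c).ne',
      ← Real.rpow_natCast (D ^ (1 - c)), ← Real.rpow_mul hD0.le, ← Real.rpow_natCast D N,
      ← Real.rpow_mul hD0.le, ← Real.rpow_neg hD0.le, ← Real.rpow_neg hD0.le,
      ← Real.rpow_add hD0]
    congr 1
    ring
  have e2 : (δ * D ^ l) ^ c * ((δ * D ^ l) ^ (1 - c) / u) = δ * (D ^ N)⁻¹ := by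
    rw [← mul_div_assoc, ← Real.rpow_add hpos, huD]
    simp
    field_simp
  rw [mul_add, e1, e2]
  have : (D ^ (1 - c)) ^ N * (D ^ N)⁻¹ ≤ δ * (D ^ N)⁻¹ := by gcongr
  linarith

/-- Holes of levels `l` to `l + N - 1` are counted by volume. The `c`-th powers form a geometric
series of ratio `D ^ (1 - c)`, absorbed by the factor `1 - D ^ (1 - c)` in the hypothesis; the
volumes contribute equally on all `N` levels. -/
theorem sum_hits_new_le {β : Fin n → ℝ} (hβ : ∀ j, 0 < β j) (hβ1 : ∀ j, β j ≤ 1)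
    {θ c δ : ℝ} (hδ : δ ∈ Ioo (0 : ℝ) 1) (hc : c ∈ Ioo (0 : ℝ) 1)
    {w : ℕ → (Fin n → ℤ) → ι → Fin n → ℝ} {l N : ℕ} {K : Fin n → ℤ}
    (h1 : Fintype.card ι * ((∏ j, β j) ^ θ) ^ c ≤ δ ^ 2 * (1 - (∏ j, β j) ^ (1 - c)))
    (hD1 : ∏ j, β j < 1) (hN : N * (Fintype.card ι * (∏ j, β j) ^ θ) ≤ δ) :
    ∑ m ∈ Finset.Ico l (l + N), ((hits β θ w m l K).card : ℝ) *
        (((∏ j, β j) ^ ((m : ℝ) + θ) / (δ * (∏ j, β j) ^ (l + N))) ^ c +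
          (∏ j, β j) ^ ((m : ℝ) + θ) / (∏ j, β j) ^ (l + N)) ≤
      3 ^ n * (2 * δ * ((∏ j, β j) ^ N)⁻¹) := by
  set D := ∏ j, β j with hD
  have hD0 : 0 < D := Finset.prod_pos fun j _ => hβ j
  set k : ℝ := (Fintype.card ι : ℝ)
  have hk : 0 ≤ k := Nat.cast_nonneg _
  set q := D ^ (1 - c) with hq
  have hq0 : 0 < q := Real.rpow_pos_of_pos hD0 _
  have hq1 : q < 1 := Real.rpow_lt_one hD0.le hD1 (by linarith [hc.2])
  have hδ0 := hδ.1
  have hN0 : 0 < D ^ N := pow_pos hD0 _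
  have hle : ∀ i ∈ Finset.range N, ((hits β θ w (l + i) l K).card : ℝ) *
      ((D ^ (((l + i : ℕ) : ℝ) + θ) / (δ * D ^ (l + N))) ^ c +
        D ^ (((l + i : ℕ) : ℝ) + θ) / D ^ (l + N)) ≤
      3 ^ n * (D ^ N)⁻¹ * (k * (D ^ θ) ^ c / δ ^ c * q ^ (N - i) + k * D ^ θ) := by
    intro i hi
    have hi := (Finset.mem_range.1 hi).le
    have hi0 : 0 < D ^ i := pow_pos hD0 _
    have hl0 : 0 < D ^ l := pow_pos hD0 _
    have hθ0 : 0 < D ^ θ := Real.rpow_pos_of_pos hD0 _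
    have e0 : D ^ (((l + i : ℕ) : ℝ) + θ) = D ^ l * D ^ i * D ^ θ := by
      rw [Real.rpow_add hD0, Real.rpow_natCast, pow_add]
    have e1 : D ^ (((l + i : ℕ) : ℝ) + θ) / D ^ (l + N) = D ^ i / D ^ N * D ^ θ := by
      rw [e0, pow_add]
      field_simp
    have e2 : D ^ (((l + i : ℕ) : ℝ) + θ) / (δ * D ^ (l + N)) = D ^ θ / δ * (D ^ (N - i))⁻¹ := by
      have : D ^ N = D ^ (N - i) * D ^ i := by rw [← pow_add]; congr 1; omega
      rw [e0, pow_add, this]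
      have := pow_pos hD0 (N - i)
      field_simp
    have hT := card_hits_le hβ hβ1 (θ := θ) (w := w) (Nat.le_add_right l i) (K := K)
    rw [← hD] at hT
    have e3 : D ^ l / D ^ (l + i) = (D ^ i)⁻¹ := by rw [pow_add]; field_simp
    rw [e3] at hT
    rw [e1, e2]
    refine (mul_le_mul_of_nonneg_right hT (by positivity)).trans (le_of_eq ?_)
    have hNi := pow_pos hD0 (N - i)
    have e4 : (D ^ θ / δ * (D ^ (N - i))⁻¹) ^ c =
        (D ^ θ) ^ c / δ ^ c * (q ^ (N - i) * (D ^ (N - i))⁻¹) := by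
      rw [Real.mul_rpow (by positivity) (by positivity), Real.div_rpow (by positivity) hδ0.le]
      congr 1
      rw [hq, ← Real.rpow_natCast (D ^ (1 - c)), ← Real.rpow_mul hD0.le, ← Real.rpow_natCast D,
        ← Real.rpow_neg hD0.le, ← Real.rpow_mul hD0.le, ← Real.rpow_add hD0]
      congr 1
      ring
    rw [e4]
    have e5 : (D ^ N)⁻¹ = (D ^ (N - i))⁻¹ * (D ^ i)⁻¹ := by
      rw [← mul_inv, ← pow_add]; congr 2; omega
    have e6 : D ^ i / D ^ N = (D ^ (N - i))⁻¹ := by rw [div_eq_mul_inv, e5]; field_simp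
    rw [e6, e5]
    ring
  rw [Finset.sum_Ico_eq_sum_range, Nat.add_sub_cancel_left]
  refine (Finset.sum_le_sum hle).trans ?_
  rw [← Finset.mul_sum, Finset.sum_add_distrib, ← Finset.mul_sum, Finset.sum_const,
    Finset.card_range, nsmul_eq_mul]
  have hgeom : (∑ i ∈ Finset.range N, q ^ (N - i)) * (1 - q) ≤ 1 := by
    have : ∑ i ∈ Finset.range N, q ^ (N - i) = q * ∑ i ∈ Finset.range N, q ^ i := by
      rw [← Finset.sum_range_reflect (fun i => q ^ i), Finset.mul_sum]
      refine Finset.sum_congr rfl fun i hi => ?_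
      rw [← pow_succ']
      congr 1
      have := Finset.mem_range.1 hi
      omega
    rw [this, mul_assoc, geom_sum_mul_neg]
    have := pow_pos hq0 N
    nlinarith
  have hδc : δ ≤ δ ^ c := by
    simpa using Real.rpow_le_rpow_of_exponent_ge hδ0 hδ.2.le hc.2.le
  have hS0 : 0 ≤ ∑ i ∈ Finset.range N, q ^ (N - i) :=
    Finset.sum_nonneg fun i _ => by positivity
  have hfirst : k * (D ^ θ) ^ c / δ ^ c * ∑ i ∈ Finset.range N, q ^ (N - i) ≤ δ := by
    have hδc0 : 0 < δ ^ c := by positivity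
    rw [div_mul_eq_mul_div, div_le_iff₀ hδc0]
    calc _ ≤ δ ^ 2 * (1 - q) * ∑ i ∈ Finset.range N, q ^ (N - i) := by gcongr
      _ = δ ^ 2 * ((∑ i ∈ Finset.range N, q ^ (N - i)) * (1 - q)) := by ring
      _ ≤ δ ^ 2 * 1 := by gcongr
      _ = δ * δ := by ring
      _ ≤ _ := by gcongr
  calc _ ≤ 3 ^ n * (D ^ N)⁻¹ * (δ + δ) := by gcongr
    _ = _ := by ring

/-- A good cell contains many good cells of the level `N` steps further on. -/
theorem le_card_good_children {β : Fin n → ℝ} (hn : 1 ≤ n) (hβ : ∀ j, 0 < β j)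
    {θ c δ : ℝ} (hδ : δ ∈ Ioo (0 : ℝ) 1) (hc : c ∈ Ioo (0 : ℝ) 1)
    {w : ℕ → (Fin n → ℤ) → ι → Fin n → ℝ} {l N : ℕ} (hl : 1 ≤ l) {K : Fin n → ℤ}
    (hβN : ∀ j, 5 * β j ^ N < 1) (hβ1 : ∀ j, β j < 1)
    (h1 : Fintype.card ι * ((∏ j, β j) ^ θ) ^ c ≤ δ ^ 2 * (1 - (∏ j, β j) ^ (1 - c)))
    (hN1 : ((∏ j, β j) ^ (1 - c)) ^ N ≤ δ) (hN2 : N * (Fintype.card ι * (∏ j, β j) ^ θ) ≤ δ)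
    (hK : IsGood β θ c δ w l K) [DecidablePred (IsGood β θ c δ w (l + N))] :
    (((3 : ℝ) ^ n)⁻¹ * (∏ j, (1 - 5 * β j ^ N)) - 8 ^ n * (1 + 2 ^ (2 * n + 1)) * δ) *
        ((∏ j, β j) ^ N)⁻¹ ≤
      ((children β N K).filter fun K' => IsGood β θ c δ w (l + N) K').card := by
  have hbad := card_filter_not_isGood_le hβ (fun j => (hβ1 j).le) hδ.1 (θ := θ) (c := c) (w := w)
    (l := l) (N := N) (K := K)
  have hD1 : ∏ j, β j < 1 := by
    have : Nonempty (Fin n) := ⟨⟨0, hn⟩⟩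
    calc ∏ j, β j < ∏ _j : Fin n, (1 : ℝ) :=
          Finset.prod_lt_prod_of_nonempty (fun j _ => hβ j) (fun j _ => hβ1 j)
            Finset.univ_nonempty
      _ = 1 := by simp
  have hold := sum_hits_old_le hβ hδ.1 hc hK hN1
  have hnew := sum_hits_new_le hβ (fun j => (hβ1 j).le) hδ hc (w := w) (l := l) (K := K) h1 hD1 hN2
  rw [← Finset.sum_Ico_consecutive _ hl (Nat.le_add_right l N)] at hbad
  have hall := le_card_children hβ hβN K
  have hsplit : (((children β N K).filter fun K' => IsGood β θ c δ w (l + N) K').card : ℝ) +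
      ((children β N K).filter fun K' => ¬ IsGood β θ c δ w (l + N) K').card =
        (children β N K).card := by
    exact_mod_cast Finset.card_filter_add_card_filter_not _
  set D := ∏ j, β j
  have hD0 : 0 < D := Finset.prod_pos fun j _ => hβ j
  have hN0 : 0 < (D ^ N)⁻¹ := by positivity
  -- The count gives the better factor `1 - 2 β_j ^ N` and a smaller error constant; both are
  -- relaxed to the constants of the theorem.
  have hprod : ((3 : ℝ) ^ n)⁻¹ * (∏ j, (1 - 5 * β j ^ N)) ≤ ∏ j, (1 - 2 * β j ^ N) := by
    have h5 : ∀ j, 0 ≤ 1 - 5 * β j ^ N := fun j => by linarith [hβN j]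
    have h3 : ((3 : ℝ) ^ n)⁻¹ ≤ 1 := inv_le_one_of_one_le₀ (one_le_pow₀ (by norm_num))
    calc _ ≤ 1 * ∏ j, (1 - 5 * β j ^ N) :=
          mul_le_mul_of_nonneg_right h3 (Finset.prod_nonneg fun j _ => h5 j)
      _ ≤ _ := by
        rw [one_mul]
        refine Finset.prod_le_prod (fun j _ => h5 j) fun j _ => ?_
        have := pow_pos (hβ j) N
        linarith
  have hconst : (3 : ℝ) ^ n * (2 + 3 ^ n * 2) ≤ 8 ^ n * (1 + 2 ^ (2 * n + 1)) := by
    have a1 : (3 : ℝ) ^ n ≤ 4 ^ n := by gcongr; norm_num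
    have a2 : (2 : ℝ) ≤ 2 ^ n := by
      calc (2 : ℝ) = 2 ^ 1 := by norm_num
        _ ≤ 2 ^ n := pow_le_pow_right₀ (by norm_num) hn
    have a3 : (8 : ℝ) ^ n = 4 ^ n * 2 ^ n := by rw [← mul_pow]; norm_num
    have a4 : (2 : ℝ) ^ (2 * n + 1) = 4 ^ n * 2 := by rw [pow_succ, pow_mul]; norm_num
    rw [a3, a4, mul_assoc]
    have a5 : (0 : ℝ) < 4 ^ n := by positivity
    have a6 : (0 : ℝ) < 3 ^ n := by positivity
    gcongr
    nlinarith
  have hbad2 : (((children β N K).filter fun K' => ¬ IsGood β θ c δ w (l + N) K').card : ℝ) ≤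
      8 ^ n * (1 + 2 ^ (2 * n + 1)) * δ * (D ^ N)⁻¹ := by
    have hδ0 := hδ.1
    calc _ ≤ _ := hbad
      _ ≤ 3 ^ n * (2 * δ * (D ^ N)⁻¹ + 3 ^ n * (2 * δ * (D ^ N)⁻¹)) := by gcongr
      _ = (3 ^ n * (2 + 3 ^ n * 2)) * (δ * (D ^ N)⁻¹) := by ring
      _ ≤ (8 ^ n * (1 + 2 ^ (2 * n + 1))) * (δ * (D ^ N)⁻¹) := by gcongr
      _ = _ := by ring
  have := mul_le_mul_of_nonneg_right hprod hN0.le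
  rw [sub_mul]
  linarith

end Grid

/-! ### Trees of cells and their limit points -/

/-- The vertex of depth `j` on the branch `ω` of a tree of grid cells. -/
def node {P : ℕ} (K₀ : Fin n → ℤ) (child : ℕ → (Fin n → ℤ) → Fin P → Fin n → ℤ)
    (ω : ℕ → Fin P) : ℕ → Fin n → ℤ
  | 0 => K₀
  | j + 1 => child j (node K₀ child ω j) (ω j)

/-- A tree in which each vertex satisfying `Good` has `P` distinct children, again satisfying
`Good`, among its grid subcells. -/
structure IsTree {P : ℕ} (β : Fin n → ℝ) (N : ℕ) (Good : ℕ → (Fin n → ℤ) → Prop)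
    (K₀ : Fin n → ℤ) (child : ℕ → (Fin n → ℤ) → Fin P → Fin n → ℤ) : Prop where
  root : Good 0 K₀
  inj : ∀ j K, Good j K → Function.Injective (child j K)
  mem : ∀ j K, Good j K → ∀ p, child j K p ∈ children β N K
  good : ∀ j K, Good j K → ∀ p, Good (j + 1) (child j K p)

section

variable {P N : ℕ} {β : Fin n → ℝ} {Good : ℕ → (Fin n → ℤ) → Prop} {K₀ : Fin n → ℤ}
  {child : ℕ → (Fin n → ℤ) → Fin P → Fin n → ℤ}

theorem IsTree.good_node (h : IsTree β N Good K₀ child) (ω : ℕ → Fin P) (j : ℕ) :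
    Good j (node K₀ child ω j) := by
  induction j with
  | zero => exact h.root
  | succ j ih => exact h.good j _ ih _

/-- A cell determines its parent and siblings are distinct, so a vertex determines the path leading
to it. This makes vertex events cylinders for the branch measure. -/
theorem IsTree.eq_of_node_eq (h : IsTree β N Good K₀ child) (hβ : ∀ j, 0 < β j)
    {ω ω' : ℕ → Fin P} {j : ℕ} (he : node K₀ child ω j = node K₀ child ω' j) :
    ∀ i < j, ω i = ω' i := by
  induction j with
  | zero => intro i hi; omega
  | succ j ih =>
    have h1 := h.mem j _ (h.good_node ω j) (ω j)
    have h2 := h.mem j _ (h.good_node ω' j) (ω' j)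
    have h3 : child j (node K₀ child ω j) (ω j) = child j (node K₀ child ω' j) (ω' j) := he
    rw [h3] at h1
    have h4 := eq_of_mem_children hβ h1 h2
    intro i hi
    rcases Nat.lt_succ_iff_lt_or_eq.1 hi with hi | rfl
    · exact ih h4 i hi
    · rw [h4] at h3
      exact h.inj i _ (h.good_node ω' i) h3

theorem tile_nonempty (hβ : ∀ j, 0 < β j) (m : ℕ) (K : Fin n → ℤ) : (tile β m K).Nonempty :=
  nonempty_Icc.2 fun j => by
    have := pow_pos (hβ j) m
    simp only
    nlinarith

theorem IsTree.nonempty_iInter (h : IsTree β N Good K₀ child) (hβ : ∀ j, 0 < β j)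
    (ω : ℕ → Fin P) : (⋂ j, tile β (1 + j * N) (node K₀ child ω j)).Nonempty := by
  refine IsCompact.nonempty_iInter_of_sequence_nonempty_isCompact_isClosed _ (fun j => ?_)
    (fun j => tile_nonempty hβ _ _) isCompact_Icc fun j => isClosed_Icc
  have := tile_subset_of_mem_children hβ (h.mem j _ (h.good_node ω j) (ω j)) (1 + j * N)
  have e : 1 + (j + 1) * N = 1 + j * N + N := by ring
  rw [e]
  exact this

open Classical in
/-- A point of the limit set of a tree on the branch `ω`. -/
noncomputable def limitPoint (β : Fin n → ℝ) (N : ℕ) (K₀ : Fin n → ℤ)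
    (child : ℕ → (Fin n → ℤ) → Fin P → Fin n → ℤ) (ω : ℕ → Fin P) : Fin n → ℝ :=
  if h : (⋂ j, tile β (1 + j * N) (node K₀ child ω j)).Nonempty then h.some else 0

theorem IsTree.limitPoint_mem (h : IsTree β N Good K₀ child) (hβ : ∀ j, 0 < β j)
    (ω : ℕ → Fin P) (j : ℕ) :
    limitPoint β N K₀ child ω ∈ tile β (1 + j * N) (node K₀ child ω j) := by
  have := h.nonempty_iInter hβ ω
  rw [limitPoint, dif_pos this]
  exact mem_iInter.1 this.some_mem j

theorem measurable_node (j : ℕ) : Measurable fun ω : ℕ → Fin P => node K₀ child ω j := by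
  induction j with
  | zero => exact measurable_const
  | succ j ih =>
    have : Measurable fun x : (Fin n → ℤ) × Fin P => child j x.1 x.2 :=
      measurable_from_prod_countable_left fun _ => measurable_of_countable _
    exact this.comp (ih.prodMk (measurable_pi_apply j))

theorem tendsto_pow_mul_atTop {x : ℝ} (hx : x ∈ Ioo (0 : ℝ) 1) (hN : 1 ≤ N) :
    Tendsto (fun j : ℕ => x ^ (1 + j * N)) atTop (𝓝 0) := by
  refine (tendsto_pow_atTop_nhds_zero_of_lt_one hx.1.le hx.2).comp
    (tendsto_atTop_mono (fun j => ?_) tendsto_id)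
  have := Nat.le_mul_of_pos_right j hN
  simp only [id]
  omega

/-- The limit point is defined by choice, but the cells shrink to a point, so each coordinate is the
limit of the lower corners, which depend on finitely many letters. -/
theorem IsTree.measurable_limitPoint (h : IsTree β N Good K₀ child)
    (hβ : ∀ j, β j ∈ Ioo (0 : ℝ) 1) (hN : 1 ≤ N) :
    Measurable (limitPoint β N K₀ child) := by
  refine measurable_pi_lambda _ fun i => ?_
  have hm : ∀ j, Measurable fun ω : ℕ → Fin P =>
      2 * β i ^ (1 + j * N) * (node K₀ child ω j i : ℝ) := fun j =>
    (measurable_of_countable fun K : Fin n → ℤ => 2 * β i ^ (1 + j * N) * (K i : ℝ)).comp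
      (measurable_node j)
  refine measurable_of_tendsto_metrizable hm (tendsto_pi_nhds.2 fun ω => ?_)
  have h0 : Tendsto (fun j : ℕ => 2 * β i ^ (1 + j * N)) atTop (𝓝 0) := by
    simpa using (tendsto_pow_mul_atTop (hβ i) hN).const_mul 2
  rw [tendsto_iff_dist_tendsto_zero]
  refine squeeze_zero (fun _ => dist_nonneg) (fun j => ?_) h0
  obtain ⟨h1, h2⟩ := h.limitPoint_mem (fun j => (hβ j).1) ω j
  have h1 := h1 i
  have h2 := h2 i
  simp only at h1 h2
  rw [dist_comm, Real.dist_eq, abs_of_nonneg (by linarith)]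
  linarith

/-! ### Branch measure and dimension of the limit set -/

/-- The uniform probability measure on the branches of a tree with `P` children per vertex. -/
noncomputable def branchMeasure (P : ℕ) [NeZero P] : Measure (ℕ → Fin P) :=
  Measure.infinitePi fun _ => (PMF.uniformOfFintype (Fin P)).toMeasure

theorem IsTree.branchMeasure_node_le [NeZero P] (h : IsTree β N Good K₀ child)
    (hβ : ∀ j, 0 < β j) (j : ℕ) (K : Fin n → ℤ) :
    branchMeasure P {ω | node K₀ child ω j = K} ≤ ((P : ℝ≥0∞)⁻¹) ^ j := by
  by_cases hne : ∃ ω₀, node K₀ child ω₀ j = K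
  · obtain ⟨ω₀, rfl⟩ := hne
    have hsub : {ω | node K₀ child ω j = node K₀ child ω₀ j} ⊆
        Set.pi (Finset.range j) fun i => {ω₀ i} := by
      intro ω hω i hi
      exact h.eq_of_node_eq hβ hω i (by simpa using hi)
    refine (measure_mono hsub).trans (le_of_eq ?_)
    rw [branchMeasure, Measure.infinitePi_pi _ fun i _ => measurableSet_singleton _]
    simp
  · have : {ω | node K₀ child ω j = K} = ∅ :=
      eq_empty_of_forall_notMem fun ω hω => hne ⟨ω, hω⟩
    rw [this]
    simp

theorem IsTree.map_branchMeasure_Icc_le [NeZero P] (h : IsTree β N Good K₀ child)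
    (hβ : ∀ j, β j ∈ Ioo (0 : ℝ) 1) (hN : 1 ≤ N) (j : ℕ) {p q : Fin n → ℝ} (hpq : p ≤ q) :
    (branchMeasure P).map (limitPoint β N K₀ child) (Icc p q) ≤
      ENNReal.ofReal ((∏ i, ((q i - p i) / (2 * β i ^ (1 + j * N)) + 2)) * ((P : ℝ)⁻¹) ^ j) := by
  have hβ0 := fun j => (hβ j).1
  rw [Measure.map_apply (h.measurable_limitPoint hβ hN) measurableSet_Icc]
  have hsub : limitPoint β N K₀ child ⁻¹' Icc p q ⊆
      ⋃ K ∈ meetIdx β (1 + j * N) p q, {ω | node K₀ child ω j = K} := by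
    intro ω hω
    rw [mem_iUnion₂]
    exact ⟨_, mem_meetIdx hβ0 ⟨_, h.limitPoint_mem hβ0 ω j, hω⟩, rfl⟩
  refine (measure_mono hsub).trans ((measure_biUnion_finset_le _ _).trans ?_)
  refine (Finset.sum_le_card_nsmul _ _ _ fun K _ => h.branchMeasure_node_le hβ0 j K).trans ?_
  have hP : (0 : ℝ) < P := by exact_mod_cast NeZero.pos P
  have e : ((P : ℝ≥0∞)⁻¹) ^ j = ENNReal.ofReal (((P : ℝ)⁻¹) ^ j) := by
    rw [ENNReal.ofReal_pow (by positivity), ENNReal.ofReal_inv_of_pos hP, ENNReal.ofReal_natCast]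
  rw [e, nsmul_eq_mul, ← ENNReal.ofReal_natCast, ← ENNReal.ofReal_mul (Nat.cast_nonneg _)]
  exact ENNReal.ofReal_le_ofReal
    (mul_le_mul_of_nonneg_right (card_meetIdx_le hβ0 _ hpq) (by positivity))

/-- Cover the ball by cells of depth `j`, with `j` matched to `r` through the slowest contraction
`b`. Since `β_i ≤ b`, each coordinate meets at most `3 b ^ (j N) / β_i ^ (1 + j N)` cells, and the
powers of `D` cancel against the mass bound `(κ⁻¹ D ^ N) ^ j`. -/
theorem IsTree.map_branchMeasure_closedBall_le [NeZero P] (h : IsTree β N Good K₀ child)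
    (hβ : ∀ j, β j ∈ Ioo (0 : ℝ) 1) (hN : 1 ≤ N) {b κ s : ℝ} (hb : b ∈ Ioo (0 : ℝ) 1)
    (hβb : ∀ j, β j ≤ b) (hκ : 0 < κ) (hκP : κ * ((∏ j, β j) ^ N)⁻¹ ≤ P) (hs : 0 < s)
    (hbs : (b ^ N) ^ n ≤ κ * (b ^ N) ^ s) (u : Fin n → ℝ) {r : ℝ} (hr : 0 < r) (hr1 : r ≤ 1) :
    (branchMeasure P).map (limitPoint β N K₀ child) (closedBall u r) ≤
      ENNReal.ofReal (3 ^ n * (∏ j, β j)⁻¹ * ((b ^ N) ^ s)⁻¹ * r ^ s) := by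
  set D := ∏ j, β j with hD
  have hD0 : 0 < D := Finset.prod_pos fun j _ => (hβ j).1
  set y := b ^ N with hy
  have hy0 : 0 < y := pow_pos hb.1 _
  have hy1 : y < 1 := pow_lt_one₀ hb.1.le hb.2 (by omega)
  obtain ⟨j, hj1, hj2⟩ := exists_nat_pow_near_of_lt_one hr hr1 hy0 hy1
  have hball : closedBall u r = Icc (fun i => u i - r) (fun i => u i + r) := by
    rw [closedBall_pi _ hr.le, ← pi_univ_Icc]
    simp [Real.closedBall_eq_Icc]
  rw [hball]
  refine (h.map_branchMeasure_Icc_le hβ hN j fun i => by simp only; linarith).trans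
    (ENNReal.ofReal_le_ofReal ?_)
  have hyj : 0 < y ^ j := pow_pos hy0 j
  have hprod : (∏ i, ((u i + r - (u i - r)) / (2 * β i ^ (1 + j * N)) + 2)) ≤
      3 ^ n * (D⁻¹ * ((D ^ N)⁻¹) ^ j) * (y ^ j) ^ n := by
    have e : 3 ^ n * (D⁻¹ * ((D ^ N)⁻¹) ^ j) * (y ^ j) ^ n =
        ∏ i, 3 * (y ^ j / β i ^ (1 + j * N)) := by
      have hβD : ∏ i, β i ^ (1 + j * N) = D ^ (1 + j * N) := by rw [hD, Finset.prod_pow]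
      rw [Finset.prod_mul_distrib, Finset.prod_div_distrib, hβD,
        Finset.prod_const, Finset.prod_const, Finset.card_univ, Fintype.card_fin]
      rw [pow_add, mul_comm j N, pow_mul, pow_one, inv_pow]
      field_simp
    rw [e]
    refine Finset.prod_le_prod (fun i _ => ?_) fun i _ => ?_
    all_goals have hβi := pow_pos (hβ i).1 (1 + j * N)
    · have : 0 ≤ u i + r - (u i - r) := by linarith
      positivity
    · have h1 : (u i + r - (u i - r)) / (2 * β i ^ (1 + j * N)) ≤ y ^ j / β i ^ (1 + j * N) := by
        have : (u i + r - (u i - r)) / (2 * β i ^ (1 + j * N)) = r / β i ^ (1 + j * N) := by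
          field_simp; ring
        rw [this]
        gcongr
      have h2 : 1 ≤ y ^ j / β i ^ (1 + j * N) := by
        rw [one_le_div hβi, hy, ← pow_mul, mul_comm N j]
        calc β i ^ (1 + j * N) ≤ β i ^ (j * N) :=
              pow_le_pow_of_le_one (hβ i).1.le (hβ i).2.le (by omega)
          _ ≤ b ^ (j * N) := pow_le_pow_left₀ (hβ i).1.le (hβb i) _
      linarith
  have hPj : ((P : ℝ)⁻¹) ^ j ≤ (κ⁻¹ * D ^ N) ^ j := by
    refine pow_le_pow_left₀ (by positivity) ?_ j
    have : κ⁻¹ * D ^ N = (κ * (D ^ N)⁻¹)⁻¹ := by rw [mul_inv, inv_inv]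
    rw [this]
    exact inv_anti₀ (by positivity) hκP
  have hfin : (y ^ n / κ) ^ j ≤ (y ^ s)⁻¹ * r ^ s := by
    have hys : 0 < y ^ s := Real.rpow_pos_of_pos hy0 s
    calc (y ^ n / κ) ^ j ≤ (y ^ s) ^ j := by
          refine pow_le_pow_left₀ (by positivity) ?_ j
          rw [div_le_iff₀ hκ]
          linarith
      _ = (y ^ j) ^ s := by
          rw [← Real.rpow_natCast, ← Real.rpow_natCast, ← Real.rpow_mul hy0.le,
            ← Real.rpow_mul hy0.le, mul_comm]
      _ ≤ (y⁻¹ * r) ^ s := by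
          refine Real.rpow_le_rpow hyj.le ?_ hs.le
          rw [pow_succ] at hj1
          rw [inv_mul_eq_div, le_div_iff₀ hy0]
          exact hj1.le
      _ = _ := by rw [Real.mul_rpow (by positivity) hr.le, Real.inv_rpow hy0.le]
  calc _ ≤ (3 ^ n * (D⁻¹ * ((D ^ N)⁻¹) ^ j) * (y ^ j) ^ n) * (κ⁻¹ * D ^ N) ^ j := by gcongr
    _ = 3 ^ n * D⁻¹ * (y ^ n / κ) ^ j := by
        have hDN : ((D ^ N)⁻¹) ^ j * (D ^ N) ^ j = 1 := by
          rw [← mul_pow, inv_mul_cancel₀ (pow_pos hD0 N).ne', one_pow]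
        rw [mul_pow, div_pow, ← pow_mul y, ← pow_mul y, mul_comm j n, inv_pow κ]
        calc _ = 3 ^ n * D⁻¹ * (((D ^ N)⁻¹) ^ j * (D ^ N) ^ j) * (y ^ (n * j) * (κ ^ j)⁻¹) := by
              ac_rfl
          _ = _ := by rw [hDN, mul_one, div_eq_mul_inv]
    _ ≤ 3 ^ n * D⁻¹ * ((y ^ s)⁻¹ * r ^ s) := by gcongr
    _ = _ := by ring

/-- The mass distribution principle: a set of small diameter lies in a ball about any of its points,
so a multiple of `μ` is at most the `s`-dimensional Hausdorff measure. -/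
theorem le_dimH_of_closedBall_le {X : Type*} [EMetricSpace X] [MeasurableSpace X]
    [BorelSpace X] {μ : Measure X} {S : Set X} (hS : μ S ≠ 0) {c s : ℝ} (hc : 0 < c) (hs : 0 < s)
    (h : ∀ u (r : ℝ), 0 < r → r ≤ 1 →
      μ (Metric.closedEBall u (ENNReal.ofReal r)) ≤ ENNReal.ofReal (c * r ^ s)) :
    ENNReal.ofReal s ≤ dimH S := by
  have key : ∀ U : Set X, ediam U ≤ 1 →
      (ENNReal.ofReal c⁻¹ • μ) U ≤ ediam U ^ s := by
    intro U hU
    rcases U.eq_empty_or_nonempty with rfl | ⟨u, hu⟩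
    · simp
    have hle : ∀ r : ℝ, 0 < r → r ≤ 1 → ediam U ≤ ENNReal.ofReal r →
        (ENNReal.ofReal c⁻¹ • μ) U ≤ ENNReal.ofReal r ^ s := by
      intro r hr hr1 hUr
      have hsub : U ⊆ Metric.closedEBall u (ENNReal.ofReal r) := fun x hx =>
        (Metric.edist_le_ediam_of_mem hx hu).trans hUr
      rw [Measure.smul_apply, smul_eq_mul, ENNReal.ofReal_rpow_of_pos hr]
      refine (mul_le_mul_right ((measure_mono hsub).trans (h u r hr hr1)) _).trans ?_
      rw [← ENNReal.ofReal_mul (by positivity), inv_mul_cancel_left₀ hc.ne']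
    have hfin : ediam U ≠ ∞ := (hU.trans_lt ENNReal.one_lt_top).ne
    rcases eq_or_ne (ediam U) 0 with h0 | h0
    -- Zero diameter admits no ball of matching positive radius, so let `r` tend to `0`.
    · have ht : Tendsto (fun r : ℝ => ENNReal.ofReal r ^ s) (𝓝[>] 0) (𝓝 0) := by
        have h1 : Tendsto (fun r : ℝ => ENNReal.ofReal r ^ s) (𝓝 0) (𝓝 (ENNReal.ofReal 0 ^ s)) :=
          ((ENNReal.continuous_rpow_const (y := s)).comp ENNReal.continuous_ofReal).tendsto 0
        rw [ENNReal.ofReal_zero, ENNReal.zero_rpow_of_pos hs] at h1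
        exact h1.mono_left nhdsWithin_le_nhds
      rw [h0, ENNReal.zero_rpow_of_pos hs]
      refine ge_of_tendsto ht ?_
      filter_upwards [Ioc_mem_nhdsGT (zero_lt_one' ℝ)] with r hr
      exact hle r hr.1 hr.2 (by rw [h0]; exact zero_le)
    · have e := ENNReal.ofReal_toReal hfin
      have := hle (ediam U).toReal (ENNReal.toReal_pos h0 hfin)
        (ENNReal.toReal_le_of_le_ofReal zero_le_one (by simpa using hU)) e.ge
      rwa [e] at this
  have hm := Measure.le_hausdorffMeasure s (ENNReal.ofReal c⁻¹ • μ) 1 one_pos key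
  refine le_dimH_of_hausdorffMeasure_ne_zero (d := s.toNNReal) ?_
  rw [Real.coe_toNNReal _ hs.le]
  intro h0
  have h1 := hm S
  rw [h0, Measure.smul_apply, smul_eq_mul, nonpos_iff_eq_zero, mul_eq_zero] at h1
  rcases h1 with h1 | h1
  · rw [ENNReal.ofReal_eq_zero] at h1
    have : 0 < c⁻¹ := by positivity
    linarith
  · exact hS h1

theorem IsTree.le_dimH_range [NeZero P] (h : IsTree β N Good K₀ child)
    (hβ : ∀ j, β j ∈ Ioo (0 : ℝ) 1) (hN : 1 ≤ N) {b κ s : ℝ} (hb : b ∈ Ioo (0 : ℝ) 1)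
    (hβb : ∀ j, β j ≤ b) (hκ : 0 < κ) (hκP : κ * ((∏ j, β j) ^ N)⁻¹ ≤ P) (hs : 0 < s)
    (hbs : (b ^ N) ^ n ≤ κ * (b ^ N) ^ s) :
    ENNReal.ofReal s ≤ dimH (range (limitPoint β N K₀ child)) := by
  have hD0 : 0 < ∏ j, β j := Finset.prod_pos fun j _ => (hβ j).1
  have hb0 : 0 < (b ^ N) ^ s := Real.rpow_pos_of_pos (pow_pos hb.1 _) s
  refine le_dimH_of_closedBall_le (μ := (branchMeasure P).map (limitPoint β N K₀ child)) ?_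
    (c := 3 ^ n * (∏ j, β j)⁻¹ * ((b ^ N) ^ s)⁻¹) (by positivity) hs fun u r hr hr1 => ?_
  -- This inequality holds for every set, so the range need not be shown measurable.
  · have h1 : branchMeasure P (limitPoint β N K₀ child ⁻¹' range (limitPoint β N K₀ child)) ≤ _ :=
      Measure.le_map_apply (h.measurable_limitPoint hβ hN).aemeasurable _
    rw [preimage_range] at h1
    have h2 : branchMeasure P univ = 1 := by
      rw [branchMeasure]
      exact measure_univ
    rw [h2] at h1
    exact (zero_lt_one.trans_le h1).ne'
  · rw [Metric.closedEBall_ofReal hr.le]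
    exact h.map_branchMeasure_closedBall_le hβ hN hb hβb hκ hκP hs hbs u hr hr1

end

/-! ### Boxes, gaps and the thickness -/

theorem mem_box {β : Fin n → ℝ} (hβ : ∀ j, 0 < β j) {s : ℝ} {z x : Fin n → ℝ} :
    x ∈ box β s z ↔ ∀ j, |x j - z j| ≤ β j ^ s := by
  have hp : ∀ j, 0 < β j ^ s := fun j => Real.rpow_pos_of_pos (hβ j) s
  constructor
  · rintro ⟨v, hv, rfl⟩ j
    have h1 : |v j| ≤ 1 := (norm_le_pi_norm v j).trans (mem_closedBall_zero_iff.1 hv)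
    simp only [diagPow, Matrix.mulVec_diagonal, Pi.add_apply, add_sub_cancel_right, abs_mul,
      abs_of_pos (hp j)]
    have := hp j
    nlinarith
  · intro h
    refine ⟨fun j => (x j - z j) / β j ^ s, ?_, ?_⟩
    · rw [mem_closedBall_zero_iff, pi_norm_le_iff_of_nonneg zero_le_one]
      intro j
      rw [Real.norm_eq_abs, abs_div, abs_of_pos (hp j), div_le_one (hp j)]
      exact h j
    · funext j
      have := (hp j).ne'
      simp only [diagPow, Pi.add_apply, Matrix.mulVec_diagonal]
      field_simp
      ring

theorem box_subset_box {β : Fin n → ℝ} (hβ : ∀ j, β j ∈ Ioo (0 : ℝ) 1) {s t : ℝ} (hst : s ≤ t)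
    (z : Fin n → ℝ) : box β t z ⊆ box β s z := by
  intro x hx
  rw [mem_box fun j => (hβ j).1] at hx ⊢
  exact fun j => (hx j).trans (Real.rpow_le_rpow_of_exponent_ge (hβ j).1 (hβ j).2.le hst)

/-- The infimum in `S_A` is attained: the width bounds `2 β_j ^ t` pass to the limit `t → s`, and a
set of these widths fits into a box whose upper faces are at the coordinate suprema. -/
theorem exists_subset_box_of_forall_lt {β : Fin n → ℝ} (hβ : ∀ j, β j ∈ Ioo (0 : ℝ) 1)
    {U : Set (Fin n → ℝ)} (hU : U.Nonempty) {s t₀ : ℝ} (ht₀ : t₀ < s)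
    (h : ∀ t, t₀ < t → t < s → ∃ z, U ⊆ box β t z) : ∃ z, U ⊆ box β s z := by
  have hβ0 := fun j => (hβ j).1
  have hd : ∀ x ∈ U, ∀ y ∈ U, ∀ j, x j - y j ≤ 2 * β j ^ s := by
    intro x hx y hy j
    have hcont : Tendsto (fun t : ℝ => 2 * β j ^ t) (𝓝[<] s) (𝓝 (2 * β j ^ s)) :=
      ((Real.continuous_const_rpow (hβ0 j).ne').const_mul 2).continuousWithinAt
    refine ge_of_tendsto hcont ?_
    filter_upwards [Ioo_mem_nhdsLT ht₀] with t ht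
    obtain ⟨z, hz⟩ := h t ht.1 ht.2
    have h1 := abs_le.1 ((mem_box hβ0).1 (hz hx) j)
    have h2 := abs_le.1 ((mem_box hβ0).1 (hz hy) j)
    linarith [h1.2, h2.1]
  obtain ⟨p, hp⟩ := hU
  refine ⟨fun j => sSup ((fun x => x j) '' U) - β j ^ s, fun x hx => ?_⟩
  rw [mem_box hβ0]
  intro j
  have hbdd : BddAbove ((fun x : Fin n → ℝ => x j) '' U) := by
    refine ⟨p j + 2 * β j ^ s, ?_⟩
    rintro _ ⟨y, hy, rfl⟩
    have := hd y hy p hp j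
    simp only
    linarith
  have h1 : x j ≤ sSup ((fun x : Fin n → ℝ => x j) '' U) := le_csSup hbdd ⟨x, hx, rfl⟩
  have h2 : sSup ((fun x : Fin n → ℝ => x j) '' U) ≤ x j + 2 * β j ^ s := by
    refine csSup_le ⟨p j, p, hp, rfl⟩ ?_
    rintro _ ⟨y, hy, rfl⟩
    have := hd y hy x hx j
    simp only
    linarith
  rw [abs_le]
  constructor <;> linarith

theorem exists_subset_box_of_affineSize_le {β : Fin n → ℝ} (hβ : ∀ j, β j ∈ Ioo (0 : ℝ) 1)
    {U : Set (Fin n → ℝ)} (hU : U.Nonempty) {s : ℝ} (hs : 0 < s)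
    (h : ENNReal.ofReal s ≤ (affineSize β U)⁻¹) : ∃ z, U ⊆ box β s z := by
  refine exists_subset_box_of_forall_lt hβ hU hs fun t ht hts => ?_
  have h1 : affineSize β U < ENNReal.ofReal (1 / t) := by
    rw [ENNReal.le_inv_iff_le_inv, ← ENNReal.ofReal_inv_of_pos hs] at h
    refine h.trans_lt ?_
    rw [ENNReal.ofReal_lt_ofReal_iff (by positivity), one_div]
    exact inv_strictAnti₀ ht hts
  rw [affineSize] at h1
  simp only [iInf_lt_iff] at h1
  obtain ⟨u, ⟨hu, z, hz⟩, hlt⟩ := h1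
  rw [ENNReal.ofReal_lt_ofReal_iff (by positivity)] at hlt
  refine ⟨z, hz.trans (box_subset_box hβ ?_ z)⟩
  rw [le_div_iff₀ hu]
  rw [lt_div_iff₀ ht] at hlt
  linarith

theorem ofReal_le_inv_gapDist {β : Fin n → ℝ} {C : Set (Fin n → ℝ)} {J : Set ℕ}
    {G : ℕ → Set (Fin n → ℝ)} {k : ℕ} {s : ℝ} (hs : 0 < s) {z : Fin n → ℝ}
    (h1 : (G k ∩ box β s z).Nonempty)
    (h2 : (box β s z ∩ ((⋃ i ∈ {i ∈ J | i < k}, G i) ∪ outerGap C)).Nonempty) :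
    ENNReal.ofReal s ≤ (gapDist β C J G k)⁻¹ := by
  rw [ENNReal.le_inv_iff_le_inv, ← ENNReal.ofReal_inv_of_pos hs, gapDist]
  refine iInf₂_le s⁻¹ ⟨inv_pos.2 hs, z, ?_⟩
  rw [one_div, inv_inv]
  exact ⟨h1, h2⟩

/-- The outward ray from `x` avoids the unit ball, so the component of `x` is unbounded. -/
theorem mem_outerGap_of_one_lt_norm {C : Set (Fin n → ℝ)}
    (hCB : C ⊆ closedBall 0 1) {x : Fin n → ℝ} (hx : 1 < ‖x‖) : x ∈ outerGap C := by
  have hmem : ∀ t : ℝ, 1 ≤ t → t • x ∈ Cᶜ := by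
    intro t ht htC
    have := mem_closedBall_zero_iff.1 (hCB htC)
    rw [norm_smul, Real.norm_eq_abs, abs_of_nonneg (by linarith)] at this
    nlinarith
  have hxC : x ∈ Cᶜ := by simpa using hmem 1 le_rfl
  refine ⟨hxC, fun hb => ?_⟩
  have hsub : (fun t : ℝ => t • x) '' Ici 1 ⊆ connectedComponentIn Cᶜ x := by
    refine IsPreconnected.subset_connectedComponentIn ?_ ⟨1, self_mem_Ici, one_smul ℝ x⟩ ?_
    · exact isPreconnected_Ici.image _ (by fun_prop)
    · rintro _ ⟨t, ht, rfl⟩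
      exact hmem t ht
  obtain ⟨R, hR⟩ := (hb.subset hsub).exists_norm_le
  have := hR ((max 1 (R + 1)) • x) ⟨_, mem_Ici.2 (le_max_left _ _), rfl⟩
  rw [norm_smul, Real.norm_eq_abs, abs_of_nonneg (zero_le_one.trans (le_max_left _ _))] at this
  have h1 := le_max_right 1 (R + 1)
  have h2 := le_max_left 1 (R + 1)
  nlinarith

theorem exists_box_inter_outerGap (hn : 1 ≤ n) {β : Fin n → ℝ} (hβ : ∀ j, β j ∈ Ioo (0 : ℝ) 1)
    {C : Set (Fin n → ℝ)} (hCB : C ⊆ closedBall 0 1) (p : Fin n → ℝ) :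
    ∃ s, 0 < s ∧ ∃ z, p ∈ box β s z ∧ (box β s z ∩ outerGap C).Nonempty := by
  have hβ0 := fun j => (hβ j).1
  have hs : ∀ᶠ s in 𝓝[>] (0 : ℝ), ∀ j, 3 / 4 ≤ β j ^ s := by
    rw [eventually_all]
    intro j
    have h1 : Tendsto (fun t : ℝ => β j ^ t) (𝓝[>] 0) (𝓝 (β j ^ (0 : ℝ))) :=
      (Real.continuous_const_rpow (hβ0 j).ne').continuousWithinAt
    rw [Real.rpow_zero] at h1
    exact (h1.eventually (lt_mem_nhds (by norm_num : (3 / 4 : ℝ) < 1))).mono fun _ h => h.le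
  obtain ⟨s, hs, hs0⟩ := (hs.and self_mem_nhdsWithin).exists
  refine ⟨s, hs0, ?_⟩
  let i : Fin n := ⟨0, hn⟩
  -- For small `s` the box is at least `3/2` wide, so it can contain `p` and a point moved by `3/2`
  -- away from the origin in coordinate `i`, hence outside the unit ball.
  obtain ⟨ε, hε, hε'⟩ : ∃ ε : ℝ, |ε| = 3 / 4 ∧ 1 < |p i + 2 * ε| := by
    rcases le_total 0 (p i) with h | h
    · refine ⟨3 / 4, by norm_num, ?_⟩
      rw [abs_of_nonneg (by linarith)]
      linarith
    · refine ⟨-(3 / 4), by norm_num [abs_of_pos], ?_⟩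
      rw [abs_of_nonpos (by linarith)]
      linarith
  refine ⟨p + Pi.single i ε, ?_, p + Pi.single i (2 * ε), ?_, ?_⟩
  · rw [mem_box hβ0]
    intro j
    refine le_trans ?_ (hs j)
    rcases eq_or_ne j i with rfl | hj
    · simp [hε]
    · simp only [Pi.add_apply, Pi.single_eq_of_ne hj]
      norm_num
  · rw [mem_box hβ0]
    intro j
    refine le_trans ?_ (hs j)
    rcases eq_or_ne j i with rfl | hj
    · simp only [Pi.add_apply, Pi.single_eq_same]
      rw [← hε]
      exact le_of_eq (congrArg _ (by ring))
    · simp only [Pi.add_apply, Pi.single_eq_of_ne hj]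
      norm_num
  · refine mem_outerGap_of_one_lt_norm hCB (hε'.trans_le ?_)
    have := norm_le_pi_norm (p + Pi.single i (2 * ε)) i
    simpa using this

/-- The gap estimate provided by a finite thickness. -/
theorem gap_subset_box {β : Fin n → ℝ} (hβ : ∀ j, β j ∈ Ioo (0 : ℝ) 1)
    {C : Set (Fin n → ℝ)} {J : Set ℕ} {G : ℕ → Set (Fin n → ℝ)}
    (hbot : thickness β C J G ≠ ⊥) (htop : thickness β C J G ≠ ⊤)
    (hτ : 0 < (thickness β C J G).toReal) {k : ℕ} (hk : k ∈ J) {s : ℝ} (hs : 0 < s)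
    {z : Fin n → ℝ} (h1 : (G k ∩ box β s z).Nonempty)
    (h2 : (box β s z ∩ ((⋃ i ∈ {i ∈ J | i < k}, G i) ∪ outerGap C)).Nonempty) :
    ∃ w, G k ⊆ box β (s + (thickness β C J G).toReal) w := by
  have hle := ofReal_le_inv_gapDist hs h1 h2
  set τ := (thickness β C J G).toReal with hτd
  have hτe : (τ : EReal) = thickness β C J G := EReal.coe_toReal htop hbot
  have hJ : J ≠ ∅ := by rintro rfl; exact hk
  have hgd : ¬ ∃ k ∈ J, gapDist β C J G k = 0 := by
    intro h
    rw [thickness, if_neg hJ, if_pos h] at hbot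
    exact hbot rfl
  rw [thickness, if_neg hJ, if_neg hgd] at hτe
  have hτk : (τ : EReal) ≤ (((affineSize β (G k))⁻¹ : ENNReal) : EReal) -
      (((gapDist β C J G k)⁻¹ : ENNReal) : EReal) := hτe.le.trans (iInf₂_le k hk)
  have hgk : gapDist β C J G k ≠ 0 := fun h => hgd ⟨k, hk, h⟩
  refine exists_subset_box_of_affineSize_le hβ (h1.mono inter_subset_left) (by positivity) ?_
  set g := (gapDist β C J G k)⁻¹
  set a := (affineSize β (G k))⁻¹
  have hg : g ≠ ∞ := by simpa [g] using hgk
  rcases eq_or_ne a ∞ with ha | ha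
  · rw [ha]; exact le_top
  have e1 : (g : EReal) = ((g.toReal : ℝ) : EReal) := (EReal.coe_ennreal_toReal hg).symm
  have e2 : (a : EReal) = ((a.toReal : ℝ) : EReal) := (EReal.coe_ennreal_toReal ha).symm
  rw [e1, e2, ← EReal.coe_sub, EReal.coe_le_coe_iff] at hτk
  rw [ENNReal.ofReal_le_iff_le_toReal ha]
  rw [ENNReal.ofReal_le_iff_le_toReal hg] at hle
  linarith

open Classical in
/-- The centre of a box of exponent `m + (τ - 1)` containing the first gap that meets the box of
exponent `m` and centre `z`, if there is such a box. -/
noncomputable def firstGapCentre (β : Fin n → ℝ) (J : Set ℕ) (G : ℕ → Set (Fin n → ℝ)) (θ : ℝ)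
    (m : ℕ) (z : Fin n → ℝ) : Fin n → ℝ :=
  if h : ∃ w k, k ∈ J ∧ (G k ∩ box β m z).Nonempty ∧
      (∀ i ∈ J, i < k → ¬ (G i ∩ box β m z).Nonempty) ∧ G k ⊆ box β ((m : ℝ) + θ) w
  then h.choose else 0

/-- The least index of a gap meeting the box is unique, so one centre depending only on the box
serves: one hole per cell and point of `F` suffices. -/
theorem subset_box_firstGapCentre {β : Fin n → ℝ} {J : Set ℕ} {G : ℕ → Set (Fin n → ℝ)} {θ : ℝ}
    {m : ℕ} {z : Fin n → ℝ} {k : ℕ} (hk : k ∈ J) (h1 : (G k ∩ box β m z).Nonempty)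
    (h2 : ∀ i ∈ J, i < k → ¬ (G i ∩ box β m z).Nonempty)
    (h3 : ∃ w, G k ⊆ box β ((m : ℝ) + θ) w) :
    G k ⊆ box β ((m : ℝ) + θ) (firstGapCentre β J G θ m z) := by
  obtain ⟨w, hw⟩ := h3
  have h : ∃ w k, k ∈ J ∧ (G k ∩ box β m z).Nonempty ∧
      (∀ i ∈ J, i < k → ¬ (G i ∩ box β m z).Nonempty) ∧ G k ⊆ box β ((m : ℝ) + θ) w :=
    ⟨w, k, hk, h1, h2, hw⟩
  rw [firstGapCentre, dif_pos h]
  obtain ⟨k', hk', h1', h2', h3'⟩ := h.choose_spec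
  rcases lt_trichotomy k k' with hlt | rfl | hlt
  · exact absurd h1 (h2' k hk hlt)
  · exact h3'
  · exact absurd h1' (h2 k' hk' hlt)

/-- A point surrounded by boxes of all exponents that avoids the gaps deleted on behalf of these
boxes lies in `C ∪ E`. -/
theorem mem_union_outerGap (hn : 1 ≤ n) {β : Fin n → ℝ} (hβ : ∀ j, β j ∈ Ioo (0 : ℝ) 1)
    {C : Set (Fin n → ℝ)} (hCB : C ⊆ closedBall 0 1) {J : Set ℕ} {G : ℕ → Set (Fin n → ℝ)}
    (hG : IsGapEnumeration β C J G)
    (hbot : thickness β C J G ≠ ⊥) (htop : thickness β C J G ≠ ⊤)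
    (hτ : 0 < (thickness β C J G).toReal) {z : ℕ → Fin n → ℝ} {x : Fin n → ℝ}
    (hx : ∀ m : ℕ, 1 ≤ m → x ∈ box β m (z m))
    (hx' : ∀ m : ℕ, 1 ≤ m → x ∉ box β ((m : ℝ) + ((thickness β C J G).toReal - 1))
      (firstGapCentre β J G ((thickness β C J G).toReal - 1) m (z m))) :
    x ∈ C ∪ outerGap C := by
  classical
  by_contra hxS
  rw [mem_union, not_or] at hxS
  obtain ⟨hxC, hxE⟩ := hxS
  have hbd : Bornology.IsBounded (connectedComponentIn Cᶜ x) := by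
    by_contra h
    exact hxE ⟨hxC, h⟩
  have hgap : connectedComponentIn Cᶜ x ∈ boundedGaps C := ⟨x, hxC, rfl, hbd⟩
  rw [← hG.image_eq] at hgap
  obtain ⟨k, hk, hkx⟩ := hgap
  have hxk : x ∈ G k := by rw [hkx]; exact mem_connectedComponentIn hxC
  set τ := (thickness β C J G).toReal with hτd
  have hmeet : ∀ m : ℕ, 1 ≤ m → (G k ∩ box β m (z m)).Nonempty := fun m hm => ⟨x, hxk, hx m hm⟩
  have hprev : ∀ m : ℕ, 1 ≤ m → (∀ i ∈ J, i < k → ¬ (G i ∩ box β m (z m)).Nonempty) →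
      ¬ ∃ w, G k ⊆ box β ((m : ℝ) + (τ - 1)) w := fun m hm h hw =>
    hx' m hm (subset_box_firstGapCentre hk (hmeet m hm) h hw hxk)
  have hJ : J ≠ ∅ := by rintro rfl; exact hk
  have hgd : gapDist β C J G k ≠ 0 := by
    intro h
    rw [thickness, if_neg hJ, if_pos ⟨k, hk, h⟩] at hbot
    exact hbot rfl
  -- If no earlier gap met the box of level `m`, then `G k` would be the first one there. Its
  -- proximity to `E` (for `m = 1`) or to an earlier gap at level `m - 1` would place it in a box of
  -- exponent `m - 1 + τ`, so the hole would contain `x`.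
  have hfar : ∀ m : ℕ, 1 ≤ m → ∃ i ∈ J, i < k ∧ (G i ∩ box β m (z m)).Nonempty := by
    intro m hm
    induction m, hm using Nat.le_induction with
    | base =>
      by_contra hcon
      push Not at hcon
      refine hprev 1 le_rfl (fun i hi hik => by
        rw [hcon i hi hik]; exact not_nonempty_empty) ?_
      obtain ⟨s, hs, w, hxw, hE⟩ := exists_box_inter_outerGap hn hβ hCB x
      obtain ⟨v, hv⟩ := gap_subset_box hβ hbot htop hτ hk hs ⟨x, hxk, hxw⟩
        (hE.mono (inter_subset_inter_right _ subset_union_right))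
      refine ⟨v, hv.trans (box_subset_box hβ ?_ v)⟩
      push_cast
      linarith
    | succ m hm ih =>
      by_contra hcon
      push Not at hcon
      refine hprev (m + 1) (by omega) (fun i hi hik => by
        rw [hcon i hi hik]; exact not_nonempty_empty) ?_
      obtain ⟨i, hi, hik, y, hyi, hy⟩ := ih
      obtain ⟨v, hv⟩ := gap_subset_box hβ hbot htop hτ hk (s := m)
        (by exact_mod_cast hm) (hmeet m hm)
        ⟨y, hy, Or.inl (mem_biUnion (show i ∈ {i ∈ J | i < k} from ⟨hi, hik⟩) hyi)⟩
      refine ⟨v, hv.trans (box_subset_box hβ ?_ v)⟩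
      push_cast
      linarith
  -- Earlier gaps at every level force `GD⁻¹ ≥ m` for all `m`, although it is finite.
  have hfin : (gapDist β C J G k)⁻¹ ≠ ∞ := by simpa using hgd
  obtain ⟨m, hm⟩ := exists_nat_gt ((gapDist β C J G k)⁻¹).toReal
  have hm1 : 1 ≤ m := by
    have : (0 : ℝ) < m := ENNReal.toReal_nonneg.trans_lt hm
    exact_mod_cast this
  obtain ⟨i, hi, hik, y, hyi, hy⟩ := hfar m hm1
  have := ofReal_le_inv_gapDist (s := m) (J := J) (C := C) (by exact_mod_cast hm1) (hmeet m hm1)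
    ⟨y, hy, Or.inl (mem_biUnion (show i ∈ {i ∈ J | i < k} from ⟨hi, hik⟩) hyi)⟩
  rw [ENNReal.ofReal_le_iff_le_toReal hfin] at this
  linarith

/-! ### Choice of the step `N` -/

/-- From `q ≤ exp (-t / δ ^ 2)` one gets `q ^ N ≤ exp (-1 / (2 δ))`, and `exp y ≥ (1 + y / 2) ^ 2 ≥
2 y` with `y = 1 / (2 δ)` finishes. -/
theorem pow_le_of_le_one_sub {δ q t : ℝ} (hδ : 0 < δ) (hq0 : 0 ≤ q) (hq : t ≤ δ ^ 2 * (1 - q))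
    {N : ℕ} (hN : δ ≤ 2 * (N * t)) : q ^ N ≤ δ := by
  have h1 : q ≤ Real.exp (-(t / δ ^ 2)) := by
    have h2 : t / δ ^ 2 ≤ 1 - q := by rw [div_le_iff₀ (by positivity)]; linarith
    linarith [Real.add_one_le_exp (-(t / δ ^ 2))]
  have h3 : q ^ N ≤ Real.exp (-(1 / (2 * δ))) := by
    refine (pow_le_pow_left₀ hq0 h1 N).trans ?_
    rw [← Real.exp_nat_mul, Real.exp_le_exp, mul_neg, neg_le_neg_iff, ← mul_div_assoc,
      div_le_div_iff₀ (by positivity) (by positivity)]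
    nlinarith
  refine h3.trans ?_
  rw [Real.exp_neg]
  refine inv_le_of_inv_le₀ hδ ?_
  have e : δ⁻¹ = 2 * (1 / (2 * δ)) := by field_simp
  rw [e]
  set y := 1 / (2 * δ)
  have hy : 0 < y := by positivity
  have h4 : Real.exp y = Real.exp (y / 2) ^ 2 := by rw [← Real.exp_nat_mul]; congr 1; push_cast; ring
  have h5 := Real.add_one_le_exp (y / 2)
  rw [h4]
  nlinarith [sq_nonneg (y / 2 - 1)]

theorem prod_mem_Ioo (hn : 1 ≤ n) {β : Fin n → ℝ} (hβ : ∀ j, β j ∈ Ioo (0 : ℝ) 1) :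
    ∏ j, β j ∈ Ioo (0 : ℝ) 1 := by
  have : Nonempty (Fin n) := ⟨⟨0, hn⟩⟩
  refine ⟨Finset.prod_pos fun j _ => (hβ j).1, ?_⟩
  calc ∏ j, β j < ∏ _j : Fin n, (1 : ℝ) :=
        Finset.prod_lt_prod_of_nonempty (fun j _ => (hβ j).1) (fun j _ => (hβ j).2)
          Finset.univ_nonempty
    _ = 1 := by simp

/-- Elementary consequences of `M α ^ c ≤ δ ^ 2 (1 - q)` for `a = M ^ (1 / c) α`. -/
theorem scale_bounds {M : ℕ} (hM : 1 ≤ M) {α c δ q : ℝ} (hα : 0 < α) (hc : c ∈ Ioo (0 : ℝ) 1)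
    (hδ : δ ∈ Ioo (0 : ℝ) 1) (hq : 0 < q) (h : M * α ^ c ≤ δ ^ 2 * (1 - q)) :
    0 < (M : ℝ) ^ (1 / c) * α ∧ (M : ℝ) ^ (1 / c) * α ≤ M * α ^ c ∧
      M * α ≤ (M : ℝ) ^ (1 / c) * α ∧ 1 ≤ ⌊δ * ((M : ℝ) ^ (1 / c) * α)⁻¹⌋₊ ∧
      ⌊δ * ((M : ℝ) ^ (1 / c) * α)⁻¹⌋₊ * ((M : ℝ) ^ (1 / c) * α) ≤ δ ∧
      δ ≤ 2 * (⌊δ * ((M : ℝ) ^ (1 / c) * α)⁻¹⌋₊ * ((M : ℝ) ^ (1 / c) * α)) := by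
  have hM1 : (1 : ℝ) ≤ M := by exact_mod_cast hM
  have hM0 : (0 : ℝ) < M := by linarith
  set a := (M : ℝ) ^ (1 / c) * α with ha
  have ha0 : 0 < a := by positivity
  have hac : a ^ c = M * α ^ c := by
    rw [ha, Real.mul_rpow (by positivity) hα.le, ← Real.rpow_mul hM0.le,
      one_div_mul_cancel hc.1.ne', Real.rpow_one]
  have hδ0 := hδ.1
  have hδ1 := hδ.2
  have hlt : a ^ c < δ := by
    rw [hac]
    have : 0 < δ ^ 2 := by positivity
    nlinarith
  have ha1 : a < 1 := by
    by_contra hcon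
    have := Real.one_le_rpow (not_lt.1 hcon) hc.1.le
    linarith
  have haac : a ≤ a ^ c := by
    simpa using Real.rpow_le_rpow_of_exponent_ge ha0 ha1.le hc.2.le
  have hx : 1 ≤ δ * a⁻¹ := by
    rw [← div_eq_mul_inv, one_le_div ha0]
    linarith
  have hN1 : 1 ≤ ⌊δ * a⁻¹⌋₊ := (Nat.one_le_floor_iff _).2 hx
  have hN2 : (⌊δ * a⁻¹⌋₊ : ℝ) ≤ δ * a⁻¹ := Nat.floor_le (by positivity)
  have hN3 := Nat.lt_floor_add_one (δ * a⁻¹)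
  have e : δ * a⁻¹ * a = δ := inv_mul_cancel_right₀ ha0.ne' δ
  refine ⟨ha0, hac ▸ haac, ?_, hN1, ?_, ?_⟩
  · rw [ha]
    refine mul_le_mul_of_nonneg_right ?_ hα.le
    simpa using Real.rpow_le_rpow_of_exponent_le hM1
      (show (1 : ℝ) ≤ 1 / c by rw [le_div_iff₀ hc.1]; linarith [hc.2])
  · calc _ ≤ δ * a⁻¹ * a := by gcongr
      _ = δ := e
  · have hN1' : (1 : ℝ) ≤ ⌊δ * a⁻¹⌋₊ := by exact_mod_cast hN1
    have : δ * a⁻¹ ≤ 2 * ⌊δ * a⁻¹⌋₊ := by linarith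
    calc δ = δ * a⁻¹ * a := e.symm
      _ ≤ 2 * ⌊δ * a⁻¹⌋₊ * a := by gcongr
      _ = _ := by ring

/-! ### Avoiding the holes and translating the pattern -/

/-- A set of large dimension avoiding all the holes. -/
theorem exists_avoiding_holes (hn : 1 ≤ n) {β : Fin n → ℝ} (hβ : ∀ j, β j ∈ Ioo (0 : ℝ) (1 / 5))
    {ι : Type*} [Fintype ι] {M : ℕ} (hM : 1 ≤ M) (hιM : Fintype.card ι ≤ M) {θ c δ : ℝ}
    (hc : c ∈ Ioo (0 : ℝ) 1) (hδ : δ ∈ Ioo (0 : ℝ) 1)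
    (h₁ : M * ((∏ j, β j) ^ θ) ^ c ≤ δ ^ 2 * (1 - (∏ j, β j) ^ (1 - c)))
    (w : ℕ → (Fin n → ℤ) → ι → Fin n → ℝ) {N : ℕ}
    (hN : N = ⌊δ * ((M : ℝ) ^ (1 / c) * (∏ j, β j) ^ θ)⁻¹⌋₊) {κ : ℝ}
    (hκ : κ = ((3 : ℝ) ^ n)⁻¹ * (∏ j, (1 - 5 * β j ^ N)) - 8 ^ n * (1 + 2 ^ (2 * n + 1)) * δ)
    (hκ0 : 0 < κ) :
    ∃ X : Set (Fin n → ℝ), X.Nonempty ∧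
      (∀ x ∈ X, x ∈ tile β 1 0 ∧ ∀ m, 1 ≤ m → ∀ k, x ∈ tile β m k → ∀ b, x ∉ hole β θ w m k b) ∧
      ∀ b ∈ Ioo (0 : ℝ) 1, (∀ j, β j ≤ b) → ∀ s, 0 < s → (b ^ N) ^ n ≤ κ * (b ^ N) ^ s →
        ENNReal.ofReal s ≤ dimH X := by
  classical
  have hβ0 : ∀ j, 0 < β j := fun j => (hβ j).1
  have hβ1 : ∀ j, β j < 1 := fun j => (hβ j).2.trans (by norm_num)
  obtain ⟨hD0, hD1⟩ := prod_mem_Ioo hn fun j => ⟨hβ0 j, hβ1 j⟩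
  have hα0 : 0 < (∏ j, β j) ^ θ := Real.rpow_pos_of_pos hD0 _
  have hq0 : 0 < (∏ j, β j) ^ (1 - c) := Real.rpow_pos_of_pos hD0 _
  obtain ⟨ha0, haM, hMa, hN1, hNδ, hδN⟩ := scale_bounds hM hα0 hc hδ hq0 h₁
  rw [← hN] at hN1 hNδ hδN
  have hι : (Fintype.card ι : ℝ) ≤ M := by exact_mod_cast hιM
  have hqN : ((∏ j, β j) ^ (1 - c)) ^ N ≤ δ := by
    refine pow_le_of_le_one_sub hδ.1 hq0.le h₁ (hδN.trans ?_)
    gcongr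
  have hNα : N * (Fintype.card ι * (∏ j, β j) ^ θ) ≤ δ := by
    refine le_trans ?_ hNδ
    refine mul_le_mul_of_nonneg_left (le_trans ?_ hMa) (Nat.cast_nonneg _)
    gcongr
  have h₁' : Fintype.card ι * ((∏ j, β j) ^ θ) ^ c ≤ δ ^ 2 * (1 - (∏ j, β j) ^ (1 - c)) := by
    refine le_trans ?_ h₁
    gcongr
  have hβN : ∀ j, 5 * β j ^ N < 1 := fun j => by
    have := pow_le_of_le_one (hβ0 j).le (hβ1 j).le (show N ≠ 0 by omega)
    linarith [(hβ j).2]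
  set D := ∏ j, β j with hD
  set P := ⌈κ * (D ^ N)⁻¹⌉₊ with hP
  have hPpos : 0 < κ * (D ^ N)⁻¹ := by positivity
  have : NeZero P := ⟨(Nat.ceil_pos.2 hPpos).ne'⟩
  let Good : ℕ → (Fin n → ℤ) → Prop := fun j K => IsGood β θ c δ w (1 + j * N) K
  have hchild : ∀ j K, ∃ f : Fin P → Fin n → ℤ, Good j K →
      Function.Injective f ∧ ∀ p, f p ∈ children β N K ∧ Good (j + 1) (f p) := by
    intro j K
    by_cases hg : Good j K
    · have hcard := le_card_good_children hn hβ0 hδ hc (w := w) (Nat.le_add_right 1 (j * N)) hβN hβ1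
        h₁' hqN hNα hg
      rw [← hκ, ← hD] at hcard
      set S := (children β N K).filter fun K' => IsGood β θ c δ w (1 + j * N + N) K'
      have hPS : P ≤ S.card := Nat.ceil_le.2 hcard
      refine ⟨fun p => (S.equivFin.symm (Fin.castLE hPS p) : Fin n → ℤ), fun _ => ⟨?_, fun p => ?_⟩⟩
      · exact Subtype.val_injective.comp (S.equivFin.symm.injective.comp (Fin.castLE_injective hPS))
      · have hp := Finset.mem_filter.1 (S.equivFin.symm (Fin.castLE hPS p)).2
        refine ⟨hp.1, ?_⟩
        have e : 1 + (j + 1) * N = 1 + j * N + N := by ring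
        simp only [Good, e]
        exact hp.2
    · exact ⟨fun _ => 0, fun h => absurd h hg⟩
  choose child hchild using hchild
  -- The root has level `1`, the lowest level with holes, so its potential is an empty sum.
  have hroot : Good 0 0 := by
    simp only [Good, zero_mul, add_zero, IsGood, potential, Finset.Ico_self, Finset.sum_empty]
    have := hδ.1
    positivity
  have hT : IsTree β N Good 0 child :=
    ⟨hroot, fun j K h => (hchild j K h).1, fun j K h p => ((hchild j K h).2 p).1,
      fun j K h p => ((hchild j K h).2 p).2⟩
  refine ⟨range (limitPoint β N 0 child), range_nonempty _, ?_, fun b hb hβb s hs hbs =>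
    hT.le_dimH_range (fun j => ⟨hβ0 j, hβ1 j⟩) hN1 hb hβb hκ0 (Nat.le_ceil _) hs hbs⟩
  rintro _ ⟨ω, rfl⟩
  have hmem := hT.limitPoint_mem hβ0 ω
  refine ⟨by simpa [node] using hmem 0, fun m hm k hk b hb => ?_⟩
  have hv0 : 0 < D ^ ((m : ℝ) + θ) := Real.rpow_pos_of_pos hD0 _
  -- Go so deep that the hole has larger volume than the cell; then this one hole already violates
  -- goodness.
  have hlim := (tendsto_pow_mul_atTop ⟨hD0, hD1⟩ hN1).eventually (gt_mem_nhds hv0)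
  obtain ⟨j, hj, hjm⟩ := (hlim.and (eventually_ge_atTop m)).exists
  have hgood : IsGood β θ c δ w (1 + j * N) (node 0 child ω j) := hT.good_node ω j
  have hmj : m ∈ Finset.Ico 1 (1 + j * N) := by
    have := Nat.le_mul_of_pos_right j hN1
    exact Finset.mem_Ico.2 ⟨hm, by omega⟩
  have hhit : (k, b) ∈ hits β θ w m (1 + j * N) (node 0 child ω j) :=
    (mem_hits hβ0).2 ⟨⟨_, hk, hmem j⟩, ⟨_, hb, hmem j⟩⟩
  have hcard : (1 : ℝ) ≤ (hits β θ w m (1 + j * N) (node 0 child ω j)).card := by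
    exact_mod_cast Finset.card_pos.2 ⟨_, hhit⟩
  have hterm : ((hits β θ w m (1 + j * N) (node 0 child ω j)).card : ℝ) *
      (D ^ ((m : ℝ) + θ)) ^ c ≤ (δ * D ^ (1 + j * N)) ^ c :=
    (Finset.single_le_sum (f := fun m => ((hits β θ w m (1 + j * N) (node 0 child ω j)).card : ℝ) *
      (D ^ ((m : ℝ) + θ)) ^ c) (fun i _ => by positivity) hmj).trans hgood
  have hlt : (δ * D ^ (1 + j * N)) ^ c < (D ^ ((m : ℝ) + θ)) ^ c := by
    have hδ0 := hδ.1
    refine Real.rpow_lt_rpow (by positivity) (lt_of_le_of_lt ?_ hj) hc.1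
    have := pow_pos hD0 (1 + j * N)
    nlinarith [hδ.2]
  have hvc : 0 < (D ^ ((m : ℝ) + θ)) ^ c := Real.rpow_pos_of_pos hv0 c
  nlinarith

theorem exists_mem_tile {β : Fin n → ℝ} (hβ : ∀ j, 0 < β j) (m : ℕ) (x : Fin n → ℝ) :
    ∃ k, x ∈ tile β m k := by
  refine ⟨fun j => ⌊x j / (2 * β j ^ m)⌋, fun j => ?_, fun j => ?_⟩
  all_goals have hb : 0 < 2 * β j ^ m := by have := pow_pos (hβ j) m; positivity
  · have := Int.floor_le (x j / (2 * β j ^ m))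
    rw [le_div_iff₀ hb] at this
    simp only
    linarith
  · have := (Int.lt_floor_add_one (x j / (2 * β j ^ m))).le
    rw [div_le_iff₀ hb] at this
    simp only
    linarith

theorem betaMax_mem (hn : 1 ≤ n) {β : Fin n → ℝ} (hβ : ∀ j, β j ∈ Ioo (0 : ℝ) (1 / 5)) :
    betaMax β ∈ Ioo (0 : ℝ) 1 ∧ ∀ j, β j ≤ betaMax β := by
  have : Nonempty (Fin n) := ⟨⟨0, hn⟩⟩
  have hle : ∀ j, β j ≤ betaMax β := fun j => le_ciSup (Set.finite_range β).bddAbove j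
  refine ⟨⟨(hβ ⟨0, hn⟩).1.trans_le (hle _), ?_⟩, hle⟩
  have : betaMax β ≤ 1 / 5 := ciSup_le fun j => (hβ j).2.le
  linarith

/-- The set of admissible translations contains a set avoiding holes. -/
theorem exists_translations (hn : 1 ≤ n) {β : Fin n → ℝ} (hβ : ∀ j, β j ∈ Ioo (0 : ℝ) (1 / 5))
    {C : Set (Fin n → ℝ)} (hCB : C ⊆ closedBall 0 1) {J : Set ℕ} {G : ℕ → Set (Fin n → ℝ)}
    (hG : IsGapEnumeration β C J G)
    (hbot : thickness β C J G ≠ ⊥) (htop : thickness β C J G ≠ ⊤)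
    (hτ : 0 < (thickness β C J G).toReal) (F : Finset (Fin n → ℝ)) {b₀ : Fin n → ℝ} (hb₀ : b₀ ∈ F)
    (y : Fin n → ℝ) {r : ℝ} (hr : 0 < r)
    (hrF : r * diam (F : Set (Fin n → ℝ)) < 1 - betaMax β) :
    ∃ (w : ℕ → (Fin n → ℤ) → F → Fin n → ℝ) (o : Fin n → ℝ), ∀ x ∈ tile β 1 0,
      (∀ m, 1 ≤ m → ∀ k, x ∈ tile β m k → ∀ b,
        x ∉ hole β ((thickness β C J G).toReal - 1) w m k b) →
      (fun b => r • b + (x + o)) '' (F : Set (Fin n → ℝ)) ⊆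
        (C ∪ outerGap C) ∩ closedBall y 1 := by
  have hβ0 : ∀ j, 0 < β j := fun j => (hβ j).1
  have hβ1 : ∀ j, β j ∈ Ioo (0 : ℝ) 1 := fun j => ⟨hβ0 j, (hβ j).2.trans (by norm_num)⟩
  set θ := (thickness β C J G).toReal - 1
  -- On the root cell `0 ≤ x j ≤ 2 β j`, so this shift puts the image of `b₀` within `β j` of `y j`.
  -- The other points are then within `r * diam F + β_max < 1` of `y`.
  let o : Fin n → ℝ := fun j => y j - r * b₀ j - β j
  -- `z` is the centre of the cell as seen from the point `b`; `w` pulls the corresponding hole back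
  -- to the space of translations.
  let z : ℕ → (Fin n → ℤ) → (Fin n → ℝ) → Fin n → ℝ := fun m k b j =>
    o j + 2 * β j ^ m * k j + β j ^ m + r * b j
  let w : ℕ → (Fin n → ℤ) → F → Fin n → ℝ := fun m k b j =>
    firstGapCentre β J G θ m (z m k b) j - r * b.1 j - o j
  refine ⟨w, o, fun x hx0 hx => ?_⟩
  rintro _ ⟨b, hb, rfl⟩
  refine ⟨?_, ?_⟩
  · choose k hk using fun m => exists_mem_tile hβ0 m x
    refine mem_union_outerGap hn hβ1 hCB hG hbot htop hτ (z := fun m => z m (k m) b)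
      (fun m hm => ?_) fun m hm hmem => ?_
    · rw [mem_box hβ0]
      intro j
      have h1 := (hk m).1 j
      have h2 := (hk m).2 j
      simp only at h1 h2
      rw [Real.rpow_natCast, abs_le]
      simp only [z, Pi.add_apply, Pi.smul_apply, smul_eq_mul]
      constructor <;> linarith
    · refine hx m hm (k m) (hk m) ⟨b, hb⟩ ?_
      rw [mem_box hβ0] at hmem
      constructor
      all_goals
        intro j
        have h1 := abs_le.1 (hmem j)
        simp only [Pi.add_apply, Pi.smul_apply, smul_eq_mul] at h1
        simp only [w]
        linarith [h1.1, h1.2]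
  · have hdist : dist b b₀ ≤ diam (F : Set (Fin n → ℝ)) :=
      dist_le_diam_of_mem F.finite_toSet.isBounded hb hb₀
    rw [mem_closedBall, dist_pi_le_iff zero_le_one]
    intro j
    have h1 := hx0.1 j
    have h2 := hx0.2 j
    simp only [pow_one, Pi.zero_apply, Int.cast_zero, mul_zero, zero_add, mul_one] at h1 h2
    have h3 : |b j - b₀ j| ≤ diam (F : Set (Fin n → ℝ)) := by
      rw [← Real.dist_eq]
      exact (dist_le_pi_dist b b₀ j).trans hdist
    have h4 := (betaMax_mem hn hβ).2 j
    have h5 := abs_le.1 h3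
    have h6 := mul_le_mul_of_nonneg_left h5.1 hr.le
    have h7 := mul_le_mul_of_nonneg_left h5.2 hr.le
    rw [Real.dist_eq, abs_le]
    simp only [o, Pi.add_apply, Pi.smul_apply, smul_eq_mul]
    constructor <;> linarith

/-- After taking logarithms the claim becomes `|log κ| * (2 N a / δ) ≥ -log κ`, which follows from
`2 N a ≥ δ`. -/
theorem pow_le_mul_rpow_of_scale {b κ δ a : ℝ} (hb : b ∈ Ioo (0 : ℝ) 1) (hκ : 0 < κ)
    (hδ : 0 < δ) {N : ℕ} (hN : δ ≤ 2 * (N * a)) (n : ℕ) :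
    (b ^ N) ^ n ≤ κ * (b ^ N) ^ ((n : ℝ) - 2 * δ⁻¹ * |Real.log κ| * a * |Real.log b|⁻¹) := by
  have hL : Real.log b < 0 := Real.log_neg hb.1 hb.2
  have hbN : 0 < b ^ N := pow_pos hb.1 N
  rw [← Real.rpow_natCast (b ^ N) n, Real.rpow_sub hbN, mul_div_assoc', mul_comm κ,
    mul_div_assoc]
  refine le_mul_of_one_le_right (by positivity) ?_
  rw [one_le_div (by positivity), ← Real.log_le_log_iff (by positivity) hκ,
    Real.log_rpow hbN, Real.log_pow, abs_of_neg hL]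
  have e : 2 * δ⁻¹ * |Real.log κ| * a * (-Real.log b)⁻¹ * (N * Real.log b) =
      -(|Real.log κ| * (δ⁻¹ * (2 * (N * a)))) := by
    have := hL.ne
    rw [inv_neg]
    field_simp
  rw [e]
  have h1 : 1 ≤ δ⁻¹ * (2 * (N * a)) := by
    rw [inv_mul_eq_div, one_le_div hδ]
    exact hN
  nlinarith [neg_abs_le (Real.log κ), abs_nonneg (Real.log κ)]

end AffineThickness

/-! ### The main theorem -/

theorem mainTheorem6 (n : ℕ) (hn : 1 ≤ n)
    (β : Fin n → ℝ) (hβ : ∀ j, β j ∈ Set.Ioo (0 : ℝ) (1 / 5))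
    (C : Set (Fin n → ℝ)) (hC : IsCompact C) (hCB : C ⊆ Metric.closedBall 0 1)
    (J : Set ℕ) (G : ℕ → Set (Fin n → ℝ))
    (hG : AffineThickness.IsGapEnumeration β C J G)
    (hbot : AffineThickness.thickness β C J G ≠ ⊥)
    (htop : AffineThickness.thickness β C J G ≠ ⊤)
    (α : ℝ) (hα : α = AffineThickness.alphaOf β (AffineThickness.thickness β C J G).toReal)
    (c δ : ℝ) (hc : c ∈ Set.Ioo (0 : ℝ) 1) (hδ : δ ∈ Set.Ioo (0 : ℝ) 1) (M : ℕ)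
    (h₁ : M * α ^ c ≤ δ ^ 2 * (1 - (∏ j, β j) ^ (1 - c)))
    (h₂ : AffineThickness.sepFactor β α c δ M > 8 ^ n * (1 + 2 ^ (2 * n + 1)) * δ)
    (F : Finset (Fin n → ℝ)) (hF : F.Nonempty) (hFM : F.card ≤ M)
    (y : Fin n → ℝ) (r : ℝ) (hr : 0 < r)
    (hrF : r * Metric.diam (F : Set (Fin n → ℝ)) < 1 - AffineThickness.betaMax β) :
    ∃ X : Set (Fin n → ℝ), X.Nonempty ∧
      (∀ x ∈ X, (fun b => r • b + x) '' (F : Set (Fin n → ℝ)) ⊆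
        (C ∪ AffineThickness.outerGap C) ∩ Metric.closedBall y 1) ∧
      (M * α ^ c ≤
          min (δ ^ 2) ((AffineThickness.patternConst β α c δ M)⁻¹ * n *
            Real.log (AffineThickness.betaMax β)⁻¹) * (1 - (∏ j, β j) ^ (1 - c)) →
        0 < n - AffineThickness.patternConst β α c δ M * ((M : ℝ) ^ (1 / c) * α) *
            |Real.log (AffineThickness.betaMax β)|⁻¹ ∧
        ENNReal.ofReal (n - AffineThickness.patternConst β α c δ M * ((M : ℝ) ^ (1 / c) * α) *
            |Real.log (AffineThickness.betaMax β)|⁻¹) ≤ dimH X) := by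
  obtain ⟨b₀, hb₀⟩ := hF
  have hM : 1 ≤ M := (Finset.card_pos.2 ⟨b₀, hb₀⟩).trans_le hFM
  have hβ0 : ∀ j, 0 < β j := fun j => (hβ j).1
  obtain ⟨hD0, hD1⟩ := AffineThickness.prod_mem_Ioo hn fun j =>
    ⟨hβ0 j, (hβ j).2.trans (by norm_num)⟩
  have hαD : α = (∏ j, β j) ^ ((AffineThickness.thickness β C J G).toReal - 1) := by
    rw [hα, AffineThickness.alphaOf, Real.finsetProd_rpow _ _ fun j _ => (hβ0 j).le]
  have hα0 : 0 < α := by rw [hαD]; exact Real.rpow_pos_of_pos hD0 _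
  have hq0 : 0 < (∏ j, β j) ^ (1 - c) := Real.rpow_pos_of_pos hD0 _
  obtain ⟨ha0, haM, hMa, hN1, hNδ, hδN⟩ := AffineThickness.scale_bounds hM hα0 hc hδ hq0 h₁
  -- A thickness `τ ≤ 0` would give `α ≥ 1`, against `α ≤ M α ≤ a ≤ N a ≤ δ < 1` with `a = M ^ (1/c)
  -- α`.
  have hτ : 0 < (AffineThickness.thickness β C J G).toReal := by
    by_contra hcon
    have h1 : 1 ≤ α := by
      rw [hαD]
      exact Real.one_le_rpow_of_pos_of_le_one_of_nonpos hD0 hD1.le (by linarith)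
    have h2 : (1 : ℝ) ≤ M := by exact_mod_cast hM
    have h3 : (1 : ℝ) ≤ ⌊δ * ((M : ℝ) ^ (1 / c) * α)⁻¹⌋₊ := by exact_mod_cast hN1
    nlinarith [hδ.2]
  obtain ⟨⟨hb0, hb1⟩, hβb⟩ := AffineThickness.betaMax_mem hn hβ
  obtain ⟨w, o, hwo⟩ := AffineThickness.exists_translations hn hβ hCB hG hbot htop hτ F hb₀ y hr hrF
  set b := AffineThickness.betaMax β
  set a := (M : ℝ) ^ (1 / c) * α with ha
  set N := ⌊δ * a⁻¹⌋₊ with hN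
  have hκ0 : 0 < AffineThickness.sepFactor β α c δ M - 8 ^ n * (1 + 2 ^ (2 * n + 1)) * δ := by
    linarith
  rw [hαD] at h₁
  obtain ⟨X, hXne, hX, hXdim⟩ := AffineThickness.exists_avoiding_holes hn hβ hM
    (by rwa [Fintype.card_coe]) hc hδ h₁ w (N := N) (by rw [hN, ha, hαD]) rfl hκ0
  refine ⟨(fun x => x + o) '' X, hXne.image _, ?_, fun h => ?_⟩
  · rintro _ ⟨x, hx, rfl⟩
    exact hwo x (hX x hx).1 (hX x hx).2
  · have hiso : Isometry fun x : Fin n → ℝ => x + o := fun x x' => edist_add_right x x' o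
    rw [hiso.dimH_image]
    have hpos : 0 < n - AffineThickness.patternConst β α c δ M * a * |Real.log b|⁻¹ := by
      have hL : Real.log b < 0 := Real.log_neg hb0 hb1
      have hn0 : (0 : ℝ) < n := by exact_mod_cast hn
      set K := AffineThickness.patternConst β α c δ M with hK
      have hK0 : 0 ≤ K := by
        have := hδ.1
        rw [hK, AffineThickness.patternConst]
        positivity
      rcases hK0.eq_or_lt with hK0 | hK0
      · rw [← hK0]
        simpa using hn0
      · rw [abs_of_neg hL, ← div_eq_mul_inv, sub_pos, div_lt_iff₀ (by linarith)]
        have hq1 : (∏ j, β j) ^ (1 - c) < 1 := Real.rpow_lt_one hD0.le hD1 (by linarith [hc.2])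
        rw [Real.log_inv] at h
        -- Strictness comes from the factor `1 - D ^ (1 - c) < 1`.
        have h1 : a < K⁻¹ * n * -Real.log b := by
          have hp : 0 < K⁻¹ * n * -Real.log b :=
            mul_pos (mul_pos (inv_pos.2 hK0) hn0) (by linarith)
          calc a ≤ _ := haM.trans h
            _ ≤ K⁻¹ * n * -Real.log b * (1 - (∏ j, β j) ^ (1 - c)) :=
              mul_le_mul_of_nonneg_right (min_le_right _ _) (by linarith)
            _ < _ := by nlinarith
        calc K * a < K * (K⁻¹ * n * -Real.log b) := by gcongr
          _ = _ := by rw [mul_assoc, mul_inv_cancel_left₀ hK0.ne']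
    exact ⟨hpos, hXdim b ⟨hb0, hb1⟩ hβb _ hpos
      (AffineThickness.pow_le_mul_rpow_of_scale ⟨hb0, hb1⟩ hκ0 hδ.1 hδN n)⟩
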